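/- Let $m,n,c_1,c_2\ge 0$ be integers with $c_1\ge c_2$ and $2c_2-c_1>2n-2$, let $F$ be the free group on $X=\{x_1,\dots,x_m\}$, let $\gamma_1(F)=F$, $\gamma_{i+1}(F)=[\gamma_i(F),F]$, and let $G=F/\gamma_{n+1}(F)$ be the free nilpotent group of class $n$ and rank $m$. Here $[x,y]=xyx^{-1}y^{-1}$. For a set $V$ of words and a free presentation $1\to R\to F'\to G\to 1$ of a group $G$, let $V(F')$ be the verbal subgroup generated by all values of words of $V$ in $F'$, let $[RV^*F']$ be the subgroup generated by all $v(f_1,\dots,f_ir,\dots,f_k)\,v(f_1,\dots,f_i,\dots,f_k)^{-1}$ with $v\in V$, $r\in R$, $f_j\in F'$, $1\le i\le k$, and let the Baer invariant be $\mathcal VM(G)=(R\cap V(F'))/[RV^*F']$. Let $\mathcal V$ be the variety defined by the single word $[\gamma_{c_1+1},\gamma_{c_2+1}]$, i.e. $[[y_0,\dots,y_{c_1}],[z_0,\dots,z_{c_2}]]$ with left-normed inner commutators and distinct variables. Fix a total order on the formal commutators on $X$ in which commutators of smaller weight precede those of larger weight (the order within one weight is arbitrary). Basic commutators are the letters $x_i$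 and the formal commutators $[b,a]$ where $a<b$ are basic commutators and, if $b=[b_1,b_2]$, then $b_2\le a$. Put $$A=\{[\beta,\alpha] : \beta>\alpha \text{ basic},\ c_1+1\le wt(\beta)\le c_1+n,\ c_2+1\le wt(\alpha)\le c_2+n\},$$ $$C=\{[\beta,\alpha] : \beta>\alpha \text{ basic},\ c_2+n+1\le wt(\beta),\ c_1+1\le wt(\alpha),\ wt(\beta)+wt(\alpha)\le 2n+c_1+c_2+1\}.$$ Then, for the presentation of $G$ with $F'=F$ and $R=\gamma_{n+1}(F)$, one has $$R\cap V(F)=[\gamma_{c_1+1}(F),\gamma_{c_2+1}(F)],\qquad [RV^*F]=H:=[\gamma_{c_1+n+1}(F),\gamma_{c_2+1}(F)]\,[\gamma_{c_2+n+1}(F),\gamma_{c_1+1}(F)],$$ so that $\mathcal VM(G)=[\gamma_{c_1+1}(F),\gamma_{c_2+1}(F)]/H$. Every element of $A\setminus C$ is a basic commutator, and $\mathcal VM(G)$ is a free abelian group with basis the cosets $aH$, $a\in A\setminus C$ (distinct $a$ giving distinct cosets). Every other free presentation of $G$ gives a Baer invariant isomorphic to this one. -/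

import Mathlib

namespace BaerNilp

open scoped commutatorElement

universe u v

section Baer

variable {F : Type u} [Group F]

/-- The value `v(f₀, f₁, …)` of the word `v`, in countably many variables, at the tuple `f`. -/
def wordValue (f : ℕ → F) (v : FreeGroup ℕ) : F := FreeGroup.lift f v

/-- The verbal subgroup `V(F)`: the subgroup generated by all values in `F` of the words in `V`. -/
def verbalSubgroup (V : Set (FreeGroup ℕ)) (F : Type u) [Group F] : Subgroup F :=
  Subgroup.closure {g | ∃ v ∈ V, ∃ f : ℕ → F, g = wordValue f v}

/-- The subgroup `[R V* F]` generated by all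
`v(f₁, …, f_i r, …, f_k) v(f₁, …, f_i, …, f_k)⁻¹` with `v ∈ V`, `r ∈ R` and `f_j ∈ F`. -/
def verbalCommutator (V : Set (FreeGroup ℕ)) (R : Subgroup F) : Subgroup F :=
  Subgroup.closure {g | ∃ v ∈ V, ∃ f : ℕ → F, ∃ i : ℕ, ∃ r ∈ R,
    g = wordValue (Function.update f i (f i * r)) v * (wordValue f v)⁻¹}

theorem conj_wordValue (g : F) (f : ℕ → F) (v : FreeGroup ℕ) :
    g * wordValue f v * g⁻¹ = wordValue (fun j => g * f j * g⁻¹) v := by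
  have h : ((MulAut.conj g).toMonoidHom.comp (FreeGroup.lift f)) =
      FreeGroup.lift (fun j => g * f j * g⁻¹) := by
    ext j
    simp
  exact DFunLike.congr_fun h v

instance verbalCommutator_normal (V : Set (FreeGroup ℕ)) (R : Subgroup F) [hR : R.Normal] :
    (verbalCommutator V R).Normal := by
  constructor
  intro x hx g
  have key : verbalCommutator V R ≤
      (verbalCommutator V R).comap (MulAut.conj g).toMonoidHom := by
    conv_lhs => unfold verbalCommutator
    rw [Subgroup.closure_le]
    rintro _ ⟨v, hv, f, i, r, hr, rfl⟩
    refine Subgroup.subset_closure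
      ⟨v, hv, fun j => g * f j * g⁻¹, i, g * r * g⁻¹, hR.conj_mem r hr g, ?_⟩
    have h1 : (fun j => g * Function.update f i (f i * r) j * g⁻¹) =
        Function.update (fun j => g * f j * g⁻¹) i (g * f i * g⁻¹ * (g * r * g⁻¹)) := by
      funext j
      by_cases h : j = i
      · subst h
        simp [mul_assoc]
      · simp [h]
    rw [← h1, ← conj_wordValue, ← conj_wordValue]
    simp [mul_assoc]
  exact key hx

/-- The Baer invariant `(R ∩ V(F)) / [R V* F]`, with respect to the variety defined by the set of
words `V`, of the group `F / R` given by the free presentation `1 → R → F → F / R → 1`. -/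
abbrev BaerInvariant (V : Set (FreeGroup ℕ)) (R : Subgroup F) [R.Normal] : Type u :=
  ↥(R ⊓ verbalSubgroup V F) ⧸ (verbalCommutator V R).subgroupOf (R ⊓ verbalSubgroup V F)

/-- The `i`-th term `γ_i(F)` of the lower central series, `i ≥ 1`, numbered so that
`γ_1(F) = F` and `γ_{i+1}(F) = [γ_i(F), F]`. -/
def gamma (F : Type u) [Group F] (i : ℕ) : Subgroup F :=
  (⊤ : Subgroup F).lowerCentralSeries (i - 1)

instance gamma_normal (F : Type u) [Group F] (i : ℕ) : (gamma F i).Normal := by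
  unfold gamma
  infer_instance

end Baer

/-- The left-normed commutator word `[x_s, x_{s+1}, …, x_{s+c}]`, that is, the word `γ_{c+1}`
written in the `c + 1` variables starting with `x_s`. -/
def gammaWord (s : ℕ) : ℕ → FreeGroup ℕ
  | 0 => FreeGroup.of s
  | c + 1 => ⁅gammaWord s c, FreeGroup.of (s + (c + 1))⁆

/-- The outer commutator word `[γ_{c₁+1}, γ_{c₂+1}]`, the two entries having disjoint variables. -/
def outerWord (c₁ c₂ : ℕ) : FreeGroup ℕ := ⁅gammaWord 0 c₁, gammaWord (c₁ + 1) c₂⁆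

section BasicCommutators

/-- Formal commutators on the letters `X` are the elements of the free magma on `X`, the product
`b * a` standing for `[b, a]`; this is the value of a formal commutator in the free group. -/
def commutatorValue {X : Type u} : FreeMagma X → FreeGroup X
  | .of x => FreeGroup.of x
  | .mul b a => ⁅commutatorValue b, commutatorValue a⁆

/-- A total order on formal commutators in which those of smaller weight precede those of larger
weight. (The weight is `FreeMagma.length`, the number of letters counted with multiplicity.)
Within one weight the order is arbitrary. -/
structure CommutatorOrder (X : Type u) where
  lt : FreeMagma X → FreeMagma X → Prop
  isStrictTotalOrder : IsStrictTotalOrder (FreeMagma X) lt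
  lt_of_weight_lt : ∀ a b : FreeMagma X, a.length < b.length → lt a b

variable {X : Type u} (ord : CommutatorOrder X)

/-- Basic commutators: the letters, and `[b, a]` where `a < b` are basic commutators such that
`b₂ ≤ a` in case `b = [b₁, b₂]`. -/
inductive IsBasic : FreeMagma X → Prop
  | of (x : X) : IsBasic (FreeMagma.of x)
  | comm (b a : FreeMagma X) (hb : IsBasic b) (ha : IsBasic a) (hlt : ord.lt a b)
      (hle : ∀ b₁ b₂ : FreeMagma X, b = b₁ * b₂ → b₂ = a ∨ ord.lt b₂ a) : IsBasic (b * a)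

/-- The set `A` of all `[β, α]` with `β > α` basic commutators, `c₁ + 1 ≤ wt β ≤ c₁ + n` and
`c₂ + 1 ≤ wt α ≤ c₂ + n`. -/
def setA (n c₁ c₂ : ℕ) : Set (FreeMagma X) :=
  {w | ∃ β α : FreeMagma X, IsBasic ord β ∧ IsBasic ord α ∧ ord.lt α β ∧
    c₁ + 1 ≤ β.length ∧ β.length ≤ c₁ + n ∧ c₂ + 1 ≤ α.length ∧ α.length ≤ c₂ + n ∧ w = β * α}

/-- The set `C` of all `[β, α]` with `β > α` basic commutators, `c₂ + n + 1 ≤ wt β`,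
`c₁ + 1 ≤ wt α` and `wt β + wt α ≤ 2 n + c₁ + c₂ + 1`. -/
def setC (n c₁ c₂ : ℕ) : Set (FreeMagma X) :=
  {w | ∃ β α : FreeMagma X, IsBasic ord β ∧ IsBasic ord α ∧ ord.lt α β ∧
    c₂ + n + 1 ≤ β.length ∧ c₁ + 1 ≤ α.length ∧
    β.length + α.length ≤ 2 * n + c₁ + c₂ + 1 ∧ w = β * α}

end BasicCommutators

/-- The group `Q` is free abelian, with basis the (injective) family `b`: the free abelian group
on the index set is isomorphic to `Q` by an isomorphism that sends each generator `i` to `b i`. -/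
def IsFreeAbelianWithBasis {Q : Type u} [Group Q] {ι : Type v} (b : ι → Q) : Prop :=
  ∃ e : Multiplicative (FreeAbelianGroup ι) ≃* Q,
    ∀ i : ι, e (Multiplicative.ofAdd (FreeAbelianGroup.of i)) = b i

end BaerNilp

open BaerNilp

/-! Put s = c₁ + c₂ + 2 and N = s + 2n. The hypotheses give 2n ≤ c₂ + 1, so the numerator lies in
γ_s, which is contained in R, and N ≤ 2s. The two equalities of subgroups are commutator calculus:
changing one argument of `gammaWord` by an element of γ_{n+1} changes its value by an element of
γ_{c+n+1} (`wordValue_gammaWord_update`), and conversely a suitable argument equal to 1 makes the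
base value trivial.

For the basis two facts about basic commutators suffice. Generation: Hall's collection, through the
Jacobi identity modulo higher weight, shows that γ_i is generated modulo γ_j by the basic
commutators of weights i ≤ wt < j. Independence: by Lazard elimination the basic commutators of one
weight are linearly independent in the free associative ring, and these are their leading terms
under the Magnus expansion x ↦ 1 + tx. On γ_s the expansion is additive in degrees below N because N
≤ 2s.

Expanding both entries of [γ_{c₁+1}, γ_{c₂+1}] shows that A \ C generates the numerator modulo H,
since the commutators in C lie in H (`commutator_gamma_le_closure`). In the same way H is contained
in the product of γ_N with the subgroup generated by basic commutators of weights from s to N - 1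
outside A \ C (`baerDenominator_le_closure`); the weight hypothesis is what makes the commutators
occurring here basic. Hence the truncated Magnus expansion, taken modulo the span of the basic
commutators outside A \ C, kills H and keeps A \ C independent.

Independence of the presentation holds because an endomorphism of F congruent to the identity modulo
R is the identity on V(F) modulo [RV*F]. -/

namespace BaerNilp

open scoped commutatorElement

universe u v

/-! ### Lazard elimination in free associative algebras -/

section Elimination

variable (R : Type*) [CommRing R]

/-- The derivation of a free algebra that sends each generator `i` to the generator `s i`. -/
theorem exists_shift_derivation {κ : Type v} (s : κ → κ) :
    ∃ D : Module.End R (FreeAlgebra R κ), (∀ p q, D (p * q) = D p * q + p * D q) ∧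
      ∀ i, D (FreeAlgebra.ι R i) = FreeAlgebra.ι R (s i) := by
  -- D is a derivation exactly when p ↦ (p, D p; 0, p) is multiplicative, so D is the upper right
  -- entry of an algebra map prescribed on generators.
  let ψ : FreeAlgebra R κ →ₐ[R] Matrix (Fin 2) (Fin 2) (FreeAlgebra R κ) :=
    FreeAlgebra.lift R fun i =>
      !![FreeAlgebra.ι R i, FreeAlgebra.ι R (s i); 0, FreeAlgebra.ι R i]
  have hψ : ∀ p, ψ p 0 0 = p ∧ ψ p 1 1 = p ∧ ψ p 1 0 = 0 := by
    intro p
    induction p using FreeAlgebra.induction with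
    | grade0 r => simp [Algebra.algebraMap_eq_smul_one]
    | grade1 i => simp [ψ]
    | mul p q hp hq => simp [Matrix.mul_apply, hp, hq]
    | add p q hp hq => simp [hp, hq]
  refine ⟨(Matrix.entryLinearMap R (FreeAlgebra R κ) 0 1) ∘ₗ ψ.toLinearMap, ?_, ?_⟩
  · intro p q
    simp only [LinearMap.comp_apply, AlgHom.toLinearMap_apply, Matrix.entryLinearMap_apply,
      map_mul, Matrix.mul_apply, Fin.sum_univ_two]
    rw [(hψ p).1, (hψ q).2.1, add_comm]
  · intro i
    simp [ψ]

/-- Iterated commutators `[x, h, …, h]` in an associative ring. -/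
def iterBracket {A : Type v} [Ring A] (h x : A) : ℕ → A
  | 0 => x
  | k + 1 => iterBracket h x k * h - h * iterBracket h x k

theorem map_iterBracket {A B : Type*} [Ring A] [Ring B] (f : A →+* B) (h x : A) (k : ℕ) :
    f (iterBracket h x k) = iterBracket (f h) (f x) k := by
  induction k with
  | zero => rfl
  | succ k ih => simp [iterBracket, ih]

/-- Lazard elimination: if a family is free, then so is the family of all `[x, h, …, h]`, where
`h` is a fixed member and `x` runs through the other members. -/
theorem injective_lift_iterBracket {ι A : Type*} [Ring A] [Algebra R A] (x : ι → A)
    (hx : Function.Injective (FreeAlgebra.lift R x)) (h : ι) :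
    Function.Injective
      (FreeAlgebra.lift R (fun y : {i // i ≠ h} × ℕ => iterBracket (x h) (x y.1) y.2)) := by
  classical
  obtain ⟨D, hDmul, hDι⟩ :=
    exists_shift_derivation R (fun y : {i // i ≠ h} × ℕ => (y.1, y.2 + 1))
  let φ : FreeAlgebra R ({i // i ≠ h} × ℕ) →ₐ[R] FreeAlgebra R ι :=
    FreeAlgebra.lift R fun y => iterBracket (FreeAlgebra.ι R h) (FreeAlgebra.ι R y.1.1) y.2
  -- The commutator of left multiplication by y with -D is left multiplication by D y, and D raises
  -- the index k. Hence ρ ∘ φ is the left regular representation, and evaluation at 1 shows that φ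
  -- is injective.
  let ρ : FreeAlgebra R ι →ₐ[R] Module.End R (FreeAlgebra R ({i // i ≠ h} × ℕ)) :=
    FreeAlgebra.lift R fun i =>
      if hi : i = h then -D else LinearMap.mulLeft R (FreeAlgebra.ι R (⟨i, hi⟩, 0))
  have hρh : ρ (FreeAlgebra.ι R h) = -D := by simp [ρ]
  have hiter : ∀ (i : {i // i ≠ h}) (k : ℕ),
      ρ (iterBracket (FreeAlgebra.ι R h) (FreeAlgebra.ι R i.1) k) =
        LinearMap.mulLeft R (FreeAlgebra.ι R (i, k)) := by
    intro i k
    induction k with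
    | zero => simp [iterBracket, ρ, i.2]
    | succ k ih =>
      rw [iterBracket, map_sub, map_mul, map_mul, ih, hρh]
      ext p
      simp [hDmul, hDι]
  have hρφ : ∀ p, ρ (φ p) = LinearMap.mulLeft R p := by
    intro p
    induction p using FreeAlgebra.induction with
    | grade0 r =>
      ext q
      simp [Algebra.smul_def]
    | grade1 y =>
      have : φ (FreeAlgebra.ι R y) =
        iterBracket (FreeAlgebra.ι R h) (FreeAlgebra.ι R y.1.1) y.2 := by simp [φ]
      rw [this, hiter]
    | mul p q hp hq => simp [hp, hq, LinearMap.mulLeft_mul, Module.End.mul_eq_comp]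
    | add p q hp hq =>
      rw [map_add, map_add, hp, hq]
      ext r
      simp [add_mul]
  have hφ : Function.Injective φ := by
    intro p q hpq
    have := congrArg (fun f => ρ f 1) hpq
    simpa [hρφ] using this
  have hcomp : FreeAlgebra.lift R
      (fun y : {i // i ≠ h} × ℕ => iterBracket (x h) (x y.1) y.2) =
        (FreeAlgebra.lift R x).comp φ := by
    ext y
    have := map_iterBracket (FreeAlgebra.lift R x).toRingHom (FreeAlgebra.ι R h)
      (FreeAlgebra.ι R y.1.1) y.2
    simp only [AlgHom.toRingHom_eq_coe, RingHom.coe_coe, FreeAlgebra.lift_ι_apply] at this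
    simp [φ, this]
  rw [hcomp]
  exact hx.comp hφ

theorem injective_lift_comp {ι κ A : Type*} [Ring A] [Algebra R A] (x : ι → A)
    (hx : Function.Injective (FreeAlgebra.lift R x)) (f : κ → ι) (hf : Function.Injective f) :
    Function.Injective (FreeAlgebra.lift R (x ∘ f)) := by
  classical
  have h1 : FreeAlgebra.lift R (x ∘ f) =
      (FreeAlgebra.lift R x).comp (FreeAlgebra.lift R (FreeAlgebra.ι R ∘ f)) := by
    ext k
    simp
  have h2 : Function.LeftInverse
      (FreeAlgebra.lift R (fun i => if h : ∃ k, f k = i then FreeAlgebra.ι R h.choose else 0))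
      (FreeAlgebra.lift R (FreeAlgebra.ι R ∘ f)) := by
    intro p
    rw [← AlgHom.comp_apply]
    refine Eq.trans (DFunLike.congr_fun (?_ : _ = AlgHom.id R _) p) rfl
    ext k
    have hk : ∃ k', f k' = f k := ⟨k, rfl⟩
    simp [hf hk.choose_spec]
  rw [h1]
  exact hx.comp h2.injective

theorem linearIndependent_of_injective_lift {ι A : Type*} [Ring A] [Algebra R A] (x : ι → A)
    (hx : Function.Injective (FreeAlgebra.lift R x)) : LinearIndependent R x := by
  have h1 : LinearIndependent R (FreeAlgebra.ι R : ι → FreeAlgebra R ι) := by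
    have := (FreeAlgebra.basisFreeMonoid R ι).linearIndependent.comp FreeMonoid.of
      FreeMonoid.of_injective
    convert this using 1
    ext i
    simp [FreeAlgebra.basisFreeMonoid, FreeAlgebra.equivMonoidAlgebraFreeMonoid]
  have h2 := h1.map' (FreeAlgebra.lift R x).toLinearMap
    (LinearMap.ker_eq_bot.mpr hx)
  simpa [Function.comp_def] using h2

end Elimination

/-! ### Linear independence of basic commutators -/

section HallBasis

variable (R : Type*) [CommRing R] {X : Type u} (ord : CommutatorOrder X)

/-- The value of a formal commutator in the free associative ring, commutators being read as
`b * a - a * b`. -/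
noncomputable def lieValue : FreeMagma X → FreeAlgebra R X
  | .of x => FreeAlgebra.ι R x
  | .mul b a => lieValue b * lieValue a - lieValue a * lieValue b

@[simp] theorem lieValue_of (x : X) : lieValue R (FreeMagma.of x) = FreeAlgebra.ι R x := rfl

@[simp] theorem lieValue_mul (b a : FreeMagma X) :
    lieValue R (b * a) = lieValue R b * lieValue R a - lieValue R a * lieValue R b := rfl

@[simp] theorem length_of (x : X) : (FreeMagma.of x).length = 1 := rfl

@[simp] theorem length_mul (b a : FreeMagma X) : (b * a).length = b.length + a.length := rfl

variable {ord}

theorem order_irrefl (a : FreeMagma X) : ¬ ord.lt a a :=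
  ord.isStrictTotalOrder.toIrrefl.irrefl a

theorem order_trans {a b c : FreeMagma X} (h₁ : ord.lt a b) (h₂ : ord.lt b c) : ord.lt a c :=
  ord.isStrictTotalOrder.toIsTrans.trans _ _ _ h₁ h₂

theorem order_trichotomy (a b : FreeMagma X) : ord.lt a b ∨ a = b ∨ ord.lt b a := by
  have := ord.isStrictTotalOrder
  exact trichotomous_of ord.lt a b

theorem length_le_of_order {a b : FreeMagma X} (h : ord.lt a b) : a.length ≤ b.length := by
  by_contra! hlt
  exact order_irrefl a (order_trans h (ord.lt_of_weight_lt _ _ hlt))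

variable (ord)

theorem mul_ne_of (b a : FreeMagma X) (x : X) : b * a ≠ FreeMagma.of x := by
  intro h
  cases h

theorem mul_inj {b a b' a' : FreeMagma X} : b * a = b' * a' ↔ b = b' ∧ a = a' := by
  constructor
  · intro h
    cases h
    exact ⟨rfl, rfl⟩
  · rintro ⟨rfl, rfl⟩
    rfl

theorem isBasic_mul_iff {b a : FreeMagma X} : IsBasic ord (b * a) ↔
    IsBasic ord b ∧ IsBasic ord a ∧ ord.lt a b ∧
      ∀ b₁ b₂ : FreeMagma X, b = b₁ * b₂ → b₂ = a ∨ ord.lt b₂ a := by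
  constructor
  · intro h
    generalize hw : b * a = w at h
    cases h with
    | of x => exact absurd hw (mul_ne_of _ _ _)
    | comm b' a' hb ha hlt hle =>
      obtain ⟨rfl, rfl⟩ := mul_inj.mp hw
      exact ⟨hb, ha, hlt, hle⟩
  · rintro ⟨h₁, h₂, h₃, h₄⟩
    exact .comm b a h₁ h₂ h₃ h₄

/-- The alphabet that elimination of all elements of `S` leaves: the basic commutators outside `S`
that are letters or have their second entry in `S`. -/
def residual (S : Set (FreeMagma X)) : Set (FreeMagma X) :=
  {w | IsBasic ord w ∧ w ∉ S ∧ ∀ b a : FreeMagma X, w = b * a → a ∈ S}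

/-- A set of basic commutators that contains with `s` all smaller basic commutators. -/
def IsInitial (S : Set (FreeMagma X)) : Prop :=
  (∀ s ∈ S, IsBasic ord s) ∧ ∀ s ∈ S, ∀ t, IsBasic ord t → ord.lt t s → t ∈ S

variable {ord}

/-- The formal commutator `[x, h, …, h]`. -/
def iterMul (h x : FreeMagma X) : ℕ → FreeMagma X
  | 0 => x
  | k + 1 => iterMul h x k * h

theorem lieValue_iterMul (h x : FreeMagma X) (k : ℕ) :
    lieValue R (iterMul h x k) = iterBracket (lieValue R h) (lieValue R x) k := by
  induction k with
  | zero => rfl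
  | succ k ih => rw [iterMul, lieValue_mul, ih, iterBracket]

/-- This matches the new alphabet with one elimination step. If the second entry of w is h, the
first entry b again belongs to the new alphabet: b exceeds h, and its own second entry is at most h
because w is basic. So factors h can be peeled off until an old letter remains. -/
theorem residual_insert {S : Set (FreeMagma X)} {h : FreeMagma X}
    (hins : IsInitial ord (insert h S)) (hmax : ∀ s ∈ S, ord.lt s h) (w : FreeMagma X)
    (hw : w ∈ residual ord (insert h S)) :
    ∃ i ∈ residual ord S, i ≠ h ∧ ∃ k, iterMul h i k = w := by
  induction w using FreeMagma.recOnMul with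
  | ih1 x =>
    refine ⟨FreeMagma.of x, ⟨hw.1, fun hx => hw.2.1 (Or.inr hx), fun b a hba => ?_⟩,
      fun hx => hw.2.1 (Or.inl hx), 0, rfl⟩
    exact absurd hba.symm (mul_ne_of _ _ _)
  | ih2 b a ihb _ =>
    rcases hw.2.2 b a rfl with rfl | ha
    · obtain ⟨hb, ha, hlt, hle⟩ := (isBasic_mul_iff ord).mp hw.1
      have hbres : b ∈ residual ord (insert a S) := by
        refine ⟨hb, ?_, ?_⟩
        · rintro (rfl | hbS)
          · exact order_irrefl _ hlt
          · exact order_irrefl _ (order_trans hlt (hmax b hbS))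
        · intro b₁ b₂ hbb
          subst hbb
          rcases hle b₁ b₂ rfl with rfl | h'
          · exact Or.inl rfl
          · exact hins.2 a (Or.inl rfl) b₂ ((isBasic_mul_iff ord).mp hb).2.1 h'
      obtain ⟨i, hi, hne, k, hk⟩ := ihb hbres
      exact ⟨i, hi, hne, k + 1, by rw [iterMul, hk]⟩
    · refine ⟨b * a, ⟨hw.1, fun hx => hw.2.1 (Or.inr hx), fun b' a' hba => ?_⟩,
        fun hx => hw.2.1 (Or.inl hx), 0, rfl⟩
      obtain ⟨rfl, rfl⟩ := mul_inj.mp hba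
      exact ha

/-- Elimination proceeds in increasing order, so the second entry of h, being of smaller weight, has
been eliminated already and h is a letter of the current alphabet. -/
theorem mem_residual_of_max {S : Set (FreeMagma X)} {h : FreeMagma X}
    (hins : IsInitial ord (insert h S)) (hmax : ∀ s ∈ S, ord.lt s h) : h ∈ residual ord S := by
  refine ⟨hins.1 h (Or.inl rfl), fun hS => order_irrefl h (hmax h hS), ?_⟩
  rintro b a rfl
  obtain ⟨hb, ha, hlt, -⟩ := (isBasic_mul_iff ord).mp (hins.1 _ (Or.inl rfl))
  have hlt' : ord.lt a (b * a) :=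
    ord.lt_of_weight_lt _ _ (by rw [length_mul]; have := b.length_pos; omega)
  rcases hins.2 _ (Or.inl rfl) a ha hlt' with h' | h'
  · rw [← h'] at hlt'
    exact absurd hlt' (order_irrefl _)
  · exact h'

/-- The commutators that remain after elimination of a finite initial set of basic commutators
freely generate a subring of the free associative ring. -/
theorem injective_lift_residual (S : Finset (FreeMagma X)) (hS : IsInitial ord (S : Set _)) :
    Function.Injective
      (FreeAlgebra.lift R (fun w : residual ord (S : Set _) => lieValue R w.1)) := by
  classical
  have := ord.isStrictTotalOrder
  let : LinearOrder (FreeMagma X) := linearOrderOfSTO ord.lt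
  induction S using Finset.induction_on_max with
  | empty =>
    have hof : ∀ w : residual ord ((∅ : Finset (FreeMagma X)) : Set (FreeMagma X)),
        ∃ x, w.1 = FreeMagma.of x := by
      rintro ⟨w, hw⟩
      induction w using FreeMagma.recOnMul with
      | ih1 x => exact ⟨x, rfl⟩
      | ih2 b a => simpa using hw.2.2 b a rfl
    choose f hf using hof
    have hcomp : (fun w : residual ord ((∅ : Finset (FreeMagma X)) : Set (FreeMagma X)) =>
        lieValue R w.1) = FreeAlgebra.ι R ∘ f := by
      funext w
      simp [hf w]
    rw [hcomp]
    refine injective_lift_comp R _ ?_ f fun v w hvw => Subtype.ext ?_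
    · have hid : FreeAlgebra.lift R (FreeAlgebra.ι R : X → FreeAlgebra R X) = AlgHom.id R _ := by
        ext x
        simp
      rw [hid]
      exact Function.injective_id
    · rw [hf v, hf w, hvw]
  | insert h S hmax ih =>
    rw [Finset.coe_insert] at hS
    have hmax' : ∀ s ∈ (S : Set (FreeMagma X)), ord.lt s h := hmax
    have hinit : IsInitial ord (S : Set (FreeMagma X)) := by
      refine ⟨fun s hs => hS.1 s (Or.inr hs), fun s hs t ht hts => ?_⟩
      rcases hS.2 s (Or.inr hs) t ht hts with rfl | h'
      · exact absurd (order_trans hts (hmax' s hs)) (order_irrefl _)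
      · exact h'
    have hel := injective_lift_iterBracket R _ (ih hinit)
      ⟨h, mem_residual_of_max hS hmax'⟩
    have hex : ∀ w : residual ord ((insert h S : Finset (FreeMagma X)) : Set (FreeMagma X)),
        ∃ y : {i : residual ord (S : Set (FreeMagma X)) //
          i ≠ ⟨h, mem_residual_of_max hS hmax'⟩} × ℕ, iterMul h y.1.1.1 y.2 = w.1 := by
      rintro ⟨w, hw⟩
      rw [Finset.coe_insert] at hw
      obtain ⟨i, hi, hne, k, hk⟩ := residual_insert hS hmax' w hw
      exact ⟨⟨⟨⟨i, hi⟩, fun h' => hne (congrArg Subtype.val h')⟩, k⟩, hk⟩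
    choose f hf using hex
    have hcomp : (fun w : residual ord ((insert h S : Finset (FreeMagma X)) : Set (FreeMagma X)) =>
        lieValue R w.1) = (fun y : {i : residual ord (S : Set (FreeMagma X)) //
          i ≠ ⟨h, mem_residual_of_max hS hmax'⟩} × ℕ =>
            iterBracket (lieValue R h) (lieValue R y.1.1.1) y.2) ∘ f := by
      funext w
      rw [Function.comp_apply, ← lieValue_iterMul, hf]
    rw [hcomp]
    refine injective_lift_comp R _ hel f fun v w hvw => Subtype.ext ?_
    rw [← hf v, ← hf w, hvw]

theorem finite_length_le [Finite X] (d : ℕ) : {w : FreeMagma X | w.length ≤ d}.Finite := by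
  induction d with
  | zero =>
    refine Set.finite_empty.subset fun w hw => ?_
    have h₁ := w.length_pos
    have h₂ : w.length ≤ 0 := hw
    omega
  | succ d ih =>
    refine ((Set.finite_range (FreeMagma.of : X → FreeMagma X)).union
      (Set.Finite.image2 (fun b a => b * a) ih ih)).subset fun w hw => ?_
    induction w using FreeMagma.recOnMul with
    | ih1 x => exact Or.inl ⟨x, rfl⟩
    | ih2 b a =>
      have h₁ := b.length_pos
      have h₂ := a.length_pos
      have h₃ : (b * a).length ≤ d + 1 := hw
      rw [length_mul] at h₃
      refine Or.inr ⟨b, ?_, a, ?_, rfl⟩ <;> simp only [Set.mem_ofPred_eq] <;> omega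

/-- Basic commutators of a given weight are linearly independent in the free associative ring. -/
theorem linearIndependent_lieValue [Finite X] (d : ℕ) :
    LinearIndependent R (fun w : {w : FreeMagma X // IsBasic ord w ∧ w.length = d} =>
      lieValue R w.1) := by
  have hfin : {w : FreeMagma X | IsBasic ord w ∧ w.length < d}.Finite :=
    (finite_length_le d).subset fun w hw => hw.2.le
  have hinit : IsInitial ord (hfin.toFinset : Set (FreeMagma X)) := by
    rw [Set.Finite.coe_toFinset]
    exact ⟨fun s hs => hs.1, fun s hs t ht hts => ⟨ht, (length_le_of_order hts).trans_lt hs.2⟩⟩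
  have hli := linearIndependent_of_injective_lift R _ (injective_lift_residual R _ hinit)
  -- After elimination of all weights below d every basic commutator of weight d is a letter, its
  -- second entry having weight below d.
  have hres : ∀ w : {w : FreeMagma X // IsBasic ord w ∧ w.length = d},
      w.1 ∈ residual ord (hfin.toFinset : Set (FreeMagma X)) := by
    rintro ⟨w, hw, hd⟩
    rw [Set.Finite.coe_toFinset]
    refine ⟨hw, fun h => h.2.ne hd, ?_⟩
    rintro b a rfl
    refine ⟨((isBasic_mul_iff ord).mp hw).2.1, ?_⟩
    have := b.length_pos
    rw [length_mul] at hd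
    omega
  exact hli.comp (fun w => ⟨w.1, hres w⟩) fun v w h => Subtype.ext (congrArg (fun i => i.1) h)

theorem linearIndependent_int_lieValue [Finite X] (d : ℕ) :
    @LinearIndependent {w : FreeMagma X // IsBasic ord w ∧ w.length = d} ℤ _
      (fun w => lieValue ℤ w.1) _ _ (AddCommGroup.toIntModule _) := by
  have h := linearIndependent_lieValue ℤ (ord := ord) d
  convert h
  · rfl
  · rfl
  · exact Subsingleton.elim _ _

end HallBasis

/-! ### Commutators of generators and the Hall–Witt identity -/

section GroupLemmas

variable {G : Type u} [Group G]

/-- Modulo K each ⁅x', y⁆ commutes with P, so x ↦ ⁅x, y⁆ is multiplicative on P up to the order of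
the factors, and the x ∈ P with ⁅x, y⁆ ∈ Q form a subgroup. -/
theorem commutator_left_mem_of_generators {K Q P P' : Subgroup G} [K.Normal] {SP : Set G} {y : G}
    (hKQ : K ≤ Q) (hgen : P ≤ Subgroup.closure SP ⊔ P') (hSP : SP ⊆ P) (hP' : P' ≤ P)
    (h₁ : ∀ x ∈ P', ⁅x, y⁆ ∈ Q) (h₂ : ∀ x ∈ P, ∀ x' ∈ P, ⁅x, ⁅x', y⁆⁆ ∈ K)
    (hs : ∀ s ∈ SP, ⁅s, y⁆ ∈ Q) {x : G} (hx : x ∈ P) : ⁅x, y⁆ ∈ Q := by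
  let T : Subgroup G :=
    { carrier := {x | x ∈ P ∧ ⁅x, y⁆ ∈ Q}
      one_mem' := ⟨P.one_mem, by simp⟩
      mul_mem' := by
        rintro x x' ⟨hx, hxy⟩ ⟨hx', hxy'⟩
        refine ⟨P.mul_mem hx hx', ?_⟩
        have : ⁅x * x', y⁆ = ⁅x, ⁅x', y⁆⁆ * ⁅x', y⁆ * ⁅x, y⁆ := by
          simp only [commutatorElement_def]
          group
        rw [this]
        exact Q.mul_mem (Q.mul_mem (hKQ (h₂ x hx x' hx')) hxy') hxy
      inv_mem' := by
        rintro x ⟨hx, hxy⟩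
        refine ⟨P.inv_mem hx, ?_⟩
        have : ⁅x⁻¹, y⁆ = (⁅x⁻¹, ⁅x, y⁆⁆ * ⁅x, y⁆)⁻¹ := by
          simp only [commutatorElement_def]
          group
        rw [this]
        exact Q.inv_mem (Q.mul_mem (hKQ (h₂ _ (P.inv_mem hx) x hx)) hxy) }
  have : Subgroup.closure SP ⊔ P' ≤ T := by
    refine sup_le ((Subgroup.closure_le _).mpr fun s h => ⟨hSP h, hs s h⟩) fun x hx => ?_
    exact ⟨hP' hx, h₁ x hx⟩
  exact (this (hgen hx)).2

theorem commutator_mem_swap {Q : Subgroup G} {x y : G} (h : ⁅x, y⁆ ∈ Q) : ⁅y, x⁆ ∈ Q := by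
  rw [← commutatorElement_inv]
  exact Q.inv_mem h

/-- If `P` is generated by `SP` modulo `P'`, and `R` by `SR` modulo `R'`, then `⁅P, R⁆` is
generated, modulo a normal subgroup that contains `⁅P', R⁆`, `⁅P, R'⁆` and `⁅⁅P, R⁆, P ⊔ R⁆`,
by the commutators of generators. -/
theorem commutator_le_of_generators {K Q P P' R R' : Subgroup G} [K.Normal] {SP SR : Set G}
    (hKQ : K ≤ Q) (hgenP : P ≤ Subgroup.closure SP ⊔ P') (hSP : SP ⊆ P) (hP' : P' ≤ P)
    (hgenR : R ≤ Subgroup.closure SR ⊔ R') (hSR : SR ⊆ R) (hR' : R' ≤ R)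
    (h₁ : ⁅P', R⁆ ≤ K) (h₂ : ⁅P, R'⁆ ≤ K) (h₃ : ⁅P, ⁅P, R⁆⁆ ≤ K) (h₄ : ⁅R, ⁅P, R⁆⁆ ≤ K)
    (hs : ∀ s ∈ SP, ∀ t ∈ SR, ⁅s, t⁆ ∈ Q) : ⁅P, R⁆ ≤ Q := by
  rw [Subgroup.commutator_le]
  intro x hx y hy
  refine commutator_left_mem_of_generators hKQ hgenP hSP hP'
    (fun z hz => hKQ (h₁ (Subgroup.commutator_mem_commutator hz hy)))
    (fun z hz z' hz' => h₃ (Subgroup.commutator_mem_commutator hz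
      (Subgroup.commutator_mem_commutator hz' hy))) (fun s hsP => ?_) hx
  refine commutator_mem_swap (commutator_left_mem_of_generators hKQ hgenR hSR hR'
    (fun z hz => commutator_mem_swap
      (hKQ (h₂ (Subgroup.commutator_mem_commutator (hSP hsP) hz))))
    (fun z hz z' hz' => h₄ (Subgroup.commutator_mem_commutator hz ?_))
    (fun t ht => commutator_mem_swap (hs s hsP t ht)) hy)
  rw [Subgroup.commutator_comm]
  exact Subgroup.commutator_mem_commutator hz' (hSP hsP)

/-- The Hall–Witt identity for elements with central triple commutators. -/
theorem commutator_commutator_eq_of_mem_center {x y z : G}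
    (h₁ : ⁅⁅x, y⁆, z⁆ ∈ Subgroup.center G) (h₂ : ⁅⁅x, z⁆, y⁆ ∈ Subgroup.center G)
    (h₃ : ⁅⁅y, z⁆, x⁆ ∈ Subgroup.center G) (h₄ : ⁅⁅x, y⁆, ⁅y, z⁆⁆ = 1)
    (h₅ : ⁅⁅y, z⁆, ⁅z, x⁆⁆ = 1) (h₆ : ⁅⁅z, x⁆, ⁅x, y⁆⁆ = 1) :
    ⁅⁅x, y⁆, z⁆ = ⁅⁅x, z⁆, y⁆ * ⁅⁅y, z⁆, x⁆⁻¹ := by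
  have hinv : ⁅⁅z, x⁆, y⁆ = ⁅⁅x, z⁆, y⁆⁻¹ := by
    rw [← commutatorElement_inv x z, commutatorElement_inv_left, ← commutatorElement_inv _ y,
      mul_assoc, ← Subgroup.mem_center_iff.mp (Subgroup.inv_mem _ h₂), inv_mul_cancel_left]
  -- The general identity contains conjugates b c b⁻¹ = ⁅b, c⁆ c; the extra factor ⁅b, c⁆ commutes
  -- with g and drops out.
  have hconj : ∀ b c g : G, ⁅g, ⁅b, c⁆⁆ = 1 → ⁅g, c⁆ ∈ Subgroup.center G →
      ⁅g, b * c * b⁻¹⁆ = ⁅g, c⁆ := by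
    intro b c g h1 hc
    have : b * c * b⁻¹ = ⁅b, c⁆ * c := by simp [commutatorElement_def]
    rw [this, commutatorElement_mul_right_eq_mul_conj, h1, one_mul,
      Subgroup.mem_center_iff.mp hc, mul_inv_cancel_right]
  have hw := commutatorElement_commutatorElement_conj_mul x y z
  rw [hconj _ _ _ h₄ h₁, hconj _ _ _ h₅ h₃, hconj _ _ _ h₆ (hinv ▸ Subgroup.inv_mem _ h₂),
    hinv, mul_inv_eq_one] at hw
  rw [← hw, mul_inv_cancel_right]

end GroupLemmas

/-! ### Lower central series -/

section Gamma

variable {F : Type u} [Group F]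

@[simp] theorem gamma_one : gamma F 1 = ⊤ := rfl

/-- Index 0 is excluded: truncated subtraction makes γ_0 = γ_1 = F. -/
theorem gamma_succ {i : ℕ} (hi : 1 ≤ i) : gamma F (i + 1) = ⁅gamma F i, ⊤⁆ := by
  obtain ⟨j, rfl⟩ : ∃ j, i = j + 1 := ⟨i - 1, by omega⟩
  rfl

theorem gamma_antitone : Antitone (gamma F) := fun _ _ h =>
  Subgroup.lowerCentralSeries_antitone _ (Nat.sub_le_sub_right h 1)

/-- `[γ_i, γ_j] ≤ γ_{i+j}`. -/
theorem commutator_gamma_le (i j : ℕ) (hi : 1 ≤ i) (hj : 1 ≤ j) :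
    ⁅gamma F i, gamma F j⁆ ≤ gamma F (i + j) := by
  induction j, hj using Nat.le_induction generalizing i with
  | base => rw [gamma_succ hi, gamma_one]
  | succ j hj ih =>
    rw [gamma_succ hj, Subgroup.commutator_comm]
    -- The three subgroups lemma, applied in the quotient by the target term, where containment
    -- becomes triviality.
    have key := Subgroup.commutator_commutator_eq_bot_of_rotate
      (H₁ := (gamma F j).map (QuotientGroup.mk' (gamma F (i + (j + 1)))))
      (H₂ := (⊤ : Subgroup F).map (QuotientGroup.mk' (gamma F (i + (j + 1)))))
      (H₃ := (gamma F i).map (QuotientGroup.mk' (gamma F (i + (j + 1)))))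
    have hle : ∀ A : Subgroup F, A.map (QuotientGroup.mk' (gamma F (i + (j + 1)))) = ⊥ ↔
        A ≤ gamma F (i + (j + 1)) := fun A => by
      rw [Subgroup.map_eq_bot_iff, QuotientGroup.ker_mk']
    simp only [← Subgroup.map_commutator, hle] at key
    refine key ?_ ?_
    · rw [Subgroup.commutator_comm ⊤, ← gamma_succ hi, show i + (j + 1) = i + 1 + j by ring]
      exact ih (i + 1) (by omega)
    · rw [show i + (j + 1) = i + j + 1 by ring, gamma_succ (by omega)]
      exact Subgroup.commutator_mono (ih i hi) le_rfl

theorem commutator_mem_gamma {i j k : ℕ} {x y : F} (hx : x ∈ gamma F i) (hy : y ∈ gamma F j)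
    (hi : 1 ≤ i) (hj : 1 ≤ j) (hk : k ≤ i + j) : ⁅x, y⁆ ∈ gamma F k :=
  gamma_antitone hk (commutator_gamma_le i j hi hj (Subgroup.commutator_mem_commutator hx hy))

/-- Modulo γ_{i+j+k+1} the triple commutators are central and the double ones commute with each
other, so the Hall–Witt identity becomes the Jacobi identity. -/
theorem commutator_commutator_mem {i j k : ℕ} {x y z : F} (hx : x ∈ gamma F i)
    (hy : y ∈ gamma F j) (hz : z ∈ gamma F k) (hi : 1 ≤ i) (hj : 1 ≤ j) (hk : 1 ≤ k)
    {Q : Subgroup F} (hQ : gamma F (i + j + k + 1) ≤ Q) (hxz : ⁅⁅x, z⁆, y⁆ ∈ Q)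
    (hyz : ⁅⁅y, z⁆, x⁆ ∈ Q) : ⁅⁅x, y⁆, z⁆ ∈ Q := by
  set K := gamma F (i + j + k + 1)
  have hcenter : ∀ g ∈ gamma F (i + j + k), (g : F ⧸ K) ∈ Subgroup.center (F ⧸ K) := by
    intro g hg
    rw [Subgroup.mem_center_iff]
    intro h
    obtain ⟨h, rfl⟩ := QuotientGroup.mk_surjective h
    rw [eq_comm, ← commutatorElement_eq_one_iff_mul_comm, ← QuotientGroup.mk'_apply,
      ← QuotientGroup.mk'_apply, ← map_commutatorElement, QuotientGroup.mk'_apply,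
      QuotientGroup.eq_one_iff]
    exact commutator_mem_gamma (j := 1) hg (by simp) (by omega) le_rfl le_rfl
  have hmk : ∀ g h : F, ((⁅g, h⁆ : F) : F ⧸ K) = ⁅(g : F ⧸ K), (h : F ⧸ K)⁆ := fun g h =>
    map_commutatorElement (QuotientGroup.mk' K) g h
  have hone : ∀ g ∈ K, (g : F ⧸ K) = 1 := fun g hg => (QuotientGroup.eq_one_iff g).mpr hg
  have hxy' := commutator_mem_gamma hx hy hi hj le_rfl
  have hyz' := commutator_mem_gamma hy hz hj hk le_rfl
  have hxz' := commutator_mem_gamma hx hz hi hk le_rfl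
  have hzx' := commutator_mem_gamma hz hx hk hi le_rfl
  have key := commutator_commutator_eq_of_mem_center (x := (x : F ⧸ K)) (y := (y : F ⧸ K))
    (z := (z : F ⧸ K))
  simp only [← hmk] at key
  replace key := key
    (hcenter _ (commutator_mem_gamma hxy' hz (by omega) hk le_rfl))
    (hcenter _ (commutator_mem_gamma hxz' hy (by omega) hj (by omega)))
    (hcenter _ (commutator_mem_gamma hyz' hx (by omega) hi (by omega)))
    (hone _ (commutator_mem_gamma hxy' hyz' (by omega) (by omega) (by omega)))
    (hone _ (commutator_mem_gamma hyz' hzx' (by omega) (by omega) (by omega)))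
    (hone _ (commutator_mem_gamma hzx' hxy' (by omega) (by omega) (by omega)))
  rw [← QuotientGroup.mk_inv, ← QuotientGroup.mk_mul, eq_comm, QuotientGroup.eq] at key
  have := Q.mul_mem (Q.mul_mem hxz (Q.inv_mem hyz)) (hQ key)
  rwa [mul_inv_cancel_left] at this

end Gamma

/-! ### Generation of the lower central series by basic commutators -/

section HallGeneration

variable {X : Type u} {ord : CommutatorOrder X}

@[simp] theorem commutatorValue_of (x : X) :
    commutatorValue (FreeMagma.of x) = FreeGroup.of x := rfl

@[simp] theorem commutatorValue_mul (b a : FreeMagma X) :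
    commutatorValue (b * a) = ⁅commutatorValue b, commutatorValue a⁆ := rfl

theorem commutatorValue_mem_gamma (w : FreeMagma X) :
    commutatorValue w ∈ gamma (FreeGroup X) w.length := by
  induction w using FreeMagma.recOnMul with
  | ih1 x => simp
  | ih2 b a hb ha =>
    exact commutator_mem_gamma hb ha b.length_pos a.length_pos le_rfl

variable (ord)

/-- The values of the basic commutators of weights `i ≤ wt < j`. -/
def basicValues (i j : ℕ) : Set (FreeGroup X) :=
  commutatorValue '' {w | IsBasic ord w ∧ i ≤ w.length ∧ w.length < j}

/-- The subgroup generated by the basic commutators of weight `d` and by `γ_{d+1}`. -/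
def basicSpan (d : ℕ) : Subgroup (FreeGroup X) :=
  Subgroup.closure (basicValues ord d (d + 1)) ⊔ gamma (FreeGroup X) (d + 1)

variable {ord}

theorem basicValues_subset {i j : ℕ} : basicValues ord i j ⊆ gamma (FreeGroup X) i := by
  rintro _ ⟨w, ⟨-, h, -⟩, rfl⟩
  exact gamma_antitone h (commutatorValue_mem_gamma w)

theorem gamma_succ_le_basicSpan (d : ℕ) : gamma (FreeGroup X) (d + 1) ≤ basicSpan ord d :=
  le_sup_right

theorem commutatorValue_mem_basicSpan {w : FreeMagma X} {d : ℕ} (hw : IsBasic ord w)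
    (hd : w.length = d) : commutatorValue w ∈ basicSpan ord d :=
  le_sup_left (α := Subgroup (FreeGroup X))
    (Subgroup.subset_closure ⟨w, ⟨hw, hd.ge, by omega⟩, rfl⟩)

theorem basicSpan_le (d : ℕ) : basicSpan ord d ≤ gamma (FreeGroup X) d :=
  sup_le ((Subgroup.closure_le _).mpr basicValues_subset) (gamma_antitone (Nat.le_succ d))

/-- If `y` has weight `j`, and its commutator with every basic commutator of weight `i` lies in
`basicSpan (i + j)`, then so does its commutator with every element of `basicSpan i`. -/
theorem commutator_mem_basicSpan {i j : ℕ} (hi : 1 ≤ i) (hj : 1 ≤ j) {x y : FreeGroup X}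
    (hx : x ∈ basicSpan ord i) (hy : y ∈ gamma (FreeGroup X) j)
    (h : ∀ w, IsBasic ord w → w.length = i → ⁅commutatorValue w, y⁆ ∈ basicSpan ord (i + j)) :
    ⁅x, y⁆ ∈ basicSpan ord (i + j) := by
  refine commutator_left_mem_of_generators (K := gamma (FreeGroup X) (i + j + 1))
    (P := basicSpan ord i) (P' := gamma (FreeGroup X) (i + 1))
    (SP := basicValues ord i (i + 1)) (gamma_succ_le_basicSpan _) le_rfl
    (Subgroup.subset_closure.trans (le_sup_left (α := Subgroup (FreeGroup X))))
    (gamma_succ_le_basicSpan _) ?_ ?_ ?_ hx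
  · intro z hz
    exact gamma_succ_le_basicSpan _ (commutator_mem_gamma hz hy (by omega) hj (by omega))
  · intro z hz z' hz'
    exact commutator_mem_gamma (basicSpan_le i hz)
      (commutator_mem_gamma (basicSpan_le i hz') hy hi hj le_rfl) hi (by omega) (by omega)
  · rintro _ ⟨w, ⟨hw, h₁, h₂⟩, rfl⟩
    exact h w hw (by omega)

/-- The commutator of two basic commutators is a product of basic commutators of the same weight,
up to higher weight. -/
theorem commutator_commutatorValue_mem_basicSpan [Finite X] (d : ℕ) :
    ∀ u v : FreeMagma X, IsBasic ord u → IsBasic ord v → u.length + v.length = d →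
      ⁅commutatorValue u, commutatorValue v⁆ ∈ basicSpan ord d := by
  induction d using Nat.strong_induction_on with
  | _ d IH =>
  -- Within weight d the induction descends on the smaller entry v: it assumes the claim for all
  -- larger v, which is legitimate because only finitely many commutators have weight at most d.
  have hwf : (({w : FreeMagma X | w.length ≤ d}).WellFoundedOn (fun a b => ord.lt b a)) := by
    have := ord.isStrictTotalOrder
    have : IsStrictOrder (FreeMagma X) (fun a b => ord.lt b a) :=
      { irrefl := fun a => order_irrefl a
        trans := fun a b c h₁ h₂ => order_trans h₂ h₁ }
    exact (finite_length_le d).wellFoundedOn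
  suffices H : ∀ v : FreeMagma X, v.length ≤ d → IsBasic ord v → ∀ u : FreeMagma X,
      IsBasic ord u → ord.lt v u → u.length + v.length = d →
        ⁅commutatorValue u, commutatorValue v⁆ ∈ basicSpan ord d by
    intro u v hu hv huv
    rcases order_trichotomy (ord := ord) u v with h | rfl | h
    · exact commutator_mem_swap (H u (by omega) hu v hv h (by omega))
    · rw [commutatorElement_self]
      exact Subgroup.one_mem _
    · exact H v (by omega) hv u hu h huv
  intro v hv
  refine hwf.induction (P := fun v => IsBasic ord v → ∀ u : FreeMagma X,
      IsBasic ord u → ord.lt v u → u.length + v.length = d →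
        ⁅commutatorValue u, commutatorValue v⁆ ∈ basicSpan ord d) hv ?_
  intro v _ ih hv u hu hlt hd
  have ih' : ∀ p q : FreeMagma X, IsBasic ord p → IsBasic ord q → ord.lt v p → ord.lt v q →
      p.length + q.length = d → ⁅commutatorValue p, commutatorValue q⁆ ∈ basicSpan ord d := by
    intro p q hp hq hvp hvq hpq
    rcases order_trichotomy (ord := ord) p q with h | rfl | h
    · exact commutator_mem_swap
        (ih p (show p.length ≤ d by omega) hvp hp q hq h (by omega))
    · rw [commutatorElement_self]
      exact Subgroup.one_mem _
    · exact ih q (show q.length ≤ d by omega) hvq hq p hp h hpq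
  by_cases hbasic : IsBasic ord (u * v)
  · exact commutatorValue_mem_basicSpan hbasic hd
  induction u using FreeMagma.recOnMul with
  | ih1 x =>
    exact absurd (.comm _ _ hu hv hlt fun b₁ b₂ h => absurd h.symm (mul_ne_of _ _ _)) hbasic
  | ih2 u₁ u₂ =>
    obtain ⟨hu₁, hu₂, hlt₁₂, -⟩ := (isBasic_mul_iff ord).mp hu
    have hvu₂ : ord.lt v u₂ := by
      rcases order_trichotomy (ord := ord) v u₂ with h | h | h
      · exact h
      · refine absurd (.comm _ _ hu hv hlt fun b₁ b₂ hb => Or.inl ?_) hbasic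
        rw [← (mul_inj.mp hb).2, h]
      · refine absurd (.comm _ _ hu hv hlt fun b₁ b₂ hb => Or.inr ?_) hbasic
        rwa [← (mul_inj.mp hb).2]
    have hvu₁ : ord.lt v u₁ := order_trans hvu₂ hlt₁₂
    rw [length_mul] at hd
    have hp := u₁.length_pos
    have hp' := u₂.length_pos
    have hp'' := v.length_pos
    have hlong : ∀ w : FreeMagma X, v.length < w.length → ord.lt v w := fun w h =>
      ord.lt_of_weight_lt _ _ h
    rw [commutatorValue_mul]
    -- When [[u₁, u₂], v] is not basic, v < u₂. In both Jacobi terms the inner commutator expands,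
    -- by induction on the weight, into basic commutators heavier than v; the outer commutators then
    -- have both entries above v.
    refine commutator_commutator_mem (commutatorValue_mem_gamma u₁) (commutatorValue_mem_gamma u₂)
      (commutatorValue_mem_gamma v) hp hp' hp'' ?_ ?_ ?_
    · rw [hd]
      exact gamma_succ_le_basicSpan d
    · have hd' : d = u₁.length + v.length + u₂.length := by omega
      rw [hd']
      refine commutator_mem_basicSpan (by omega) hp'
        (IH _ (by omega) u₁ v hu₁ hv rfl) (commutatorValue_mem_gamma u₂) fun w hw hwl => ?_
      rw [← hd']
      exact ih' w u₂ hw hu₂ (hlong w (by omega)) hvu₂ (by omega)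
    · have hd' : d = u₂.length + v.length + u₁.length := by omega
      rw [hd']
      refine commutator_mem_basicSpan (by omega) hp
        (IH _ (by omega) u₂ v hu₂ hv rfl) (commutatorValue_mem_gamma u₁) fun w hw hwl => ?_
      rw [← hd']
      exact ih' w u₁ hw hu₁ (hlong w (by omega)) hvu₁ (by omega)

theorem gamma_le_basicSpan [Finite X] (d : ℕ) (hd : 1 ≤ d) :
    gamma (FreeGroup X) d ≤ basicSpan ord d := by
  induction d, hd using Nat.le_induction with
  | base =>
    refine le_trans ?_ le_sup_left
    rw [gamma_one, ← FreeGroup.closure_range_of]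
    refine Subgroup.closure_mono ?_
    rintro _ ⟨x, rfl⟩
    exact ⟨FreeMagma.of x, ⟨.of x, by simp, by simp⟩, rfl⟩
  | succ d hd ih =>
    have htop : (⊤ : Subgroup (FreeGroup X)) ≤ basicSpan ord 1 := by
      refine le_trans ?_ le_sup_left
      rw [← FreeGroup.closure_range_of]
      refine Subgroup.closure_mono ?_
      rintro _ ⟨x, rfl⟩
      exact ⟨FreeMagma.of x, ⟨.of x, by simp, by simp⟩, rfl⟩
    rw [gamma_succ hd, Subgroup.commutator_le]
    intro x hx y _
    refine commutator_mem_basicSpan hd le_rfl (ih hx) (by simp) fun w hw hwd => ?_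
    refine commutator_mem_swap ?_
    rw [add_comm]
    refine commutator_mem_basicSpan le_rfl hd (htop trivial)
      (hwd ▸ commutatorValue_mem_gamma w) fun w' hw' hwd' => ?_
    exact commutator_commutatorValue_mem_basicSpan _ _ _ hw' hw (by omega)

/-- `γ_i` is generated modulo `γ_j` by the basic commutators of weights `i ≤ wt < j`. -/
theorem gamma_le_closure_basicValues [Finite X] {i j : ℕ} (hi : 1 ≤ i) (hij : i ≤ j) :
    gamma (FreeGroup X) i ≤
      Subgroup.closure (basicValues ord i j) ⊔ gamma (FreeGroup X) j := by
  induction j, hij using Nat.le_induction with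
  | base => exact le_sup_right
  | succ j hj ih =>
    refine ih.trans (sup_le (le_sup_of_le_left (Subgroup.closure_mono ?_)) ?_)
    · exact Set.image_mono fun w hw => ⟨hw.1, hw.2.1, hw.2.2.trans (Nat.lt_succ_self j)⟩
    · refine (gamma_le_basicSpan (ord := ord) j (by omega)).trans (sup_le_sup_right ?_ _)
      exact Subgroup.closure_mono (Set.image_mono fun w hw => ⟨hw.1, hj.trans hw.2.1, hw.2.2⟩)

end HallGeneration

/-! ### The Magnus expansion and its leading terms -/

section Magnus

open PowerSeries

theorem coeff_mul_eq_zero {R : Type*} [Semiring R] {i j : ℕ} {p q : R⟦X⟧}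
    (hp : ∀ d < i, coeff d p = 0) (hq : ∀ d < j, coeff d q = 0) :
    ∀ d < i + j, coeff d (p * q) = 0 := by
  intro d hd
  rw [coeff_mul]
  refine Finset.sum_eq_zero fun x hx => ?_
  rw [Finset.HasAntidiagonal.mem_antidiagonal] at hx
  by_cases h : x.1 < i
  · rw [hp _ h, zero_mul]
  · rw [hq _ (by omega), mul_zero]

theorem coeff_add_mul {R : Type*} [Semiring R] {i j : ℕ} {p q : R⟦X⟧}
    (hp : ∀ d < i, coeff d p = 0) (hq : ∀ d < j, coeff d q = 0) :
    coeff (i + j) (p * q) = coeff i p * coeff j q := by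
  rw [coeff_mul]
  refine Finset.sum_eq_single (i, j) (fun x hx hne => ?_) fun h => ?_
  · rw [Finset.HasAntidiagonal.mem_antidiagonal] at hx
    by_cases h : x.1 < i
    · rw [hp _ h, zero_mul]
    · have : x.2 < j := by
        by_contra h'
        exact hne (Prod.ext (by simp; omega) (by simp; omega))
      rw [hq _ this, mul_zero]
  · exact absurd (Finset.HasAntidiagonal.mem_antidiagonal.mpr
      (rfl : (i, j).1 + (i, j).2 = i + j)) h

theorem coeff_zero_mul {R : Type*} [Semiring R] (p q : R⟦X⟧) :
    coeff 0 (p * q) = coeff 0 p * coeff 0 q := by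
  simp [coeff_mul]

variable (X : Type u)

/-- The unit `1 + t x` of the ring of power series in `t` over the free associative ring. -/
noncomputable def magnusUnit (x : X) : (FreeAlgebra ℤ X)⟦X⟧ˣ where
  val := 1 + C (FreeAlgebra.ι ℤ x) * PowerSeries.X
  inv := MvPowerSeries.invOfUnit (1 + C (FreeAlgebra.ι ℤ x) * PowerSeries.X : (FreeAlgebra ℤ X)⟦X⟧) 1
  val_inv := MvPowerSeries.mul_invOfUnit _ _ (by
    change constantCoeff _ = _
    simp)
  inv_val := MvPowerSeries.invOfUnit_mul _ _ (by
    change constantCoeff _ = _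
    simp)

/-- The Magnus representation `x ↦ 1 + t x` of the free group. -/
noncomputable def magnus : FreeGroup X →* (FreeAlgebra ℤ X)⟦X⟧ˣ :=
  FreeGroup.lift (magnusUnit X)

variable {X}

/-- The augmented Magnus expansion `μ(g) - 1`. -/
noncomputable def magnusSub (g : FreeGroup X) : (FreeAlgebra ℤ X)⟦X⟧ := (magnus X g : _) - 1

theorem magnusSub_mul (g h : FreeGroup X) :
    magnusSub (g * h) = magnusSub g + magnusSub h + magnusSub g * magnusSub h := by
  simp only [magnusSub, map_mul, Units.val_mul]
  noncomm_ring

/-- From ghg⁻¹h⁻¹ - 1 = (gh - hg)g⁻¹h⁻¹: up to higher degree, a group commutator becomes a ring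
commutator. -/
theorem magnusSub_commutator (g h : FreeGroup X) :
    magnusSub ⁅g, h⁆ = (magnusSub g * magnusSub h - magnusSub h * magnusSub g) +
      (magnusSub g * magnusSub h - magnusSub h * magnusSub g) * magnusSub (g⁻¹ * h⁻¹) := by
  have h1 : (magnusSub g * magnusSub h - magnusSub h * magnusSub g) =
      (magnus X g : (FreeAlgebra ℤ X)⟦X⟧) * (magnus X h : _) - (magnus X h : _) * (magnus X g : _) := by
    simp only [magnusSub]
    noncomm_ring
  have h2 : ∀ p : (FreeAlgebra ℤ X)⟦X⟧, p + p * magnusSub (g⁻¹ * h⁻¹) =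
      p * ((magnus X g)⁻¹.val * (magnus X h)⁻¹.val) := by
    intro p
    simp only [magnusSub, map_mul, map_inv, Units.val_mul]
    noncomm_ring
  rw [h2, h1, magnusSub, commutatorElement_def, sub_mul]
  simp only [map_mul, map_inv, Units.val_mul]
  congr 1
  · noncomm_ring
  · rw [mul_assoc, ← mul_assoc _ _ (magnus X h)⁻¹.val, Units.mul_inv, one_mul, Units.mul_inv]

theorem coeff_zero_magnusSub (g : FreeGroup X) : coeff 0 (magnusSub g) = 0 := by
  induction g using FreeGroup.induction_on with
  | C1 => simp [magnusSub]
  | of x => simp [magnusSub, magnus, magnusUnit]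
  | inv_of x ih =>
    have h := magnusSub_mul (FreeGroup.of x) (FreeGroup.of x)⁻¹
    have h' := congrArg (coeff 0) h
    rw [mul_inv_cancel, map_add, map_add, ih, coeff_zero_mul, ih, zero_mul, add_zero,
      zero_add] at h'
    rw [← h', magnusSub, map_one, Units.val_one, sub_self, map_zero]
  | mul g h hg hh =>
    rw [magnusSub_mul, map_add, map_add, coeff_zero_mul, hg, hh]
    simp

theorem coeff_magnusSub_commutator {i j : ℕ} {g h : FreeGroup X}
    (hg : ∀ d < i, coeff d (magnusSub g) = 0) (hh : ∀ d < j, coeff d (magnusSub h) = 0) :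
    (∀ d < i + j, coeff d (magnusSub ⁅g, h⁆) = 0) ∧
      coeff (i + j) (magnusSub ⁅g, h⁆) =
        coeff i (magnusSub g) * coeff j (magnusSub h) -
          coeff j (magnusSub h) * coeff i (magnusSub g) := by
  have h1 : ∀ d < i + j,
      coeff d (magnusSub g * magnusSub h - magnusSub h * magnusSub g) = 0 := by
    intro d hd
    rw [map_sub, coeff_mul_eq_zero hg hh d hd, coeff_mul_eq_zero hh hg d (by omega), sub_zero]
  have h2 : ∀ d < 1, coeff d (magnusSub (g⁻¹ * h⁻¹)) = 0 := by
    intro d hd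
    obtain rfl : d = 0 := by omega
    exact coeff_zero_magnusSub _
  have h3 := coeff_mul_eq_zero h1 h2
  rw [magnusSub_commutator]
  refine ⟨fun d hd => ?_, ?_⟩
  · rw [map_add, h1 d hd, h3 d (by omega), add_zero]
  · rw [map_add, h3 _ (Nat.lt_succ_self _), add_zero, map_sub, coeff_add_mul hg hh,
      add_comm i j, coeff_add_mul hh hg]

theorem coeff_magnusSub_commutatorValue (w : FreeMagma X) :
    (∀ d < w.length, coeff d (magnusSub (commutatorValue w)) = 0) ∧
      coeff w.length (magnusSub (commutatorValue w)) = lieValue ℤ w := by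
  induction w using FreeMagma.recOnMul with
  | ih1 x =>
    refine ⟨fun d hd => ?_, ?_⟩
    · obtain rfl : d = 0 := by simpa using hd
      exact coeff_zero_magnusSub _
    · simp [magnusSub, magnus, magnusUnit]
  | ih2 b a hb ha =>
    have := coeff_magnusSub_commutator hb.1 ha.1
    rw [hb.2, ha.2] at this
    exact this

/-- The subgroup of all `g` with `μ(g) ≡ 1` modulo `t^i`. -/
noncomputable def dimensionSubgroup (X : Type u) (i : ℕ) : Subgroup (FreeGroup X) where
  carrier := {g | ∀ d < i, coeff d (magnusSub g) = 0}
  one_mem' := fun d _ => by simp [magnusSub]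
  mul_mem' := by
    intro g h hg hh d hd
    rw [magnusSub_mul, map_add, map_add, hg d hd, hh d hd,
      coeff_mul_eq_zero hg hh d (by omega), add_zero, add_zero]
  inv_mem' := by
    intro g hg d hd
    have h := congrArg (coeff d) (magnusSub_mul g g⁻¹)
    rw [mul_inv_cancel, map_add, map_add, hg d hd,
      coeff_mul_eq_zero (i := i) (j := 0) hg (by simp) d (by omega)] at h
    simpa [magnusSub] using h.symm

theorem gamma_le_dimensionSubgroup (i : ℕ) (hi : 1 ≤ i) :
    gamma (FreeGroup X) i ≤ dimensionSubgroup X i := by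
  induction i, hi using Nat.le_induction with
  | base =>
    intro g _ d hd
    obtain rfl : d = 0 := by omega
    exact coeff_zero_magnusSub g
  | succ i hi ih =>
    rw [gamma_succ hi, Subgroup.commutator_le]
    intro g hg h _
    refine (coeff_magnusSub_commutator (ih hg) (j := 1) fun d hd => ?_).1
    obtain rfl : d = 0 := by omega
    exact coeff_zero_magnusSub h

/-- On `γ_s`, the coefficients of the Magnus expansion in degrees below `N ≤ 2 s` are additive. -/
noncomputable def truncatedMagnus (s N : ℕ) (hs : 1 ≤ s) (hN : N ≤ 2 * s) :
    gamma (FreeGroup X) s →* Multiplicative (ℕ → FreeAlgebra ℤ X) where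
  toFun g := .ofAdd fun d => if d < N then coeff d (magnusSub g.1) else 0
  map_one' := by
    refine congrArg Multiplicative.ofAdd (funext fun d => ?_)
    simp [magnusSub]
  map_mul' := by
    intro g h
    rw [← ofAdd_add]
    refine congrArg Multiplicative.ofAdd (funext fun d => ?_)
    rw [Pi.add_apply]
    split_ifs with hd
    · rw [Subgroup.coe_mul, magnusSub_mul, map_add, map_add,
        coeff_mul_eq_zero (gamma_le_dimensionSubgroup s hs g.2)
          (gamma_le_dimensionSubgroup s hs h.2) d (by omega), add_zero]
    · rw [add_zero]

theorem truncatedMagnus_eq_one {s N : ℕ} (hs : 1 ≤ s) (hN : N ≤ 2 * s) (hN' : 1 ≤ N)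
    (g : gamma (FreeGroup X) s) (hg : g.1 ∈ gamma (FreeGroup X) N) :
    truncatedMagnus s N hs hN g = 1 := by
  refine congrArg Multiplicative.ofAdd (funext fun d => ?_)
  split_ifs with hd
  · exact gamma_le_dimensionSubgroup N hN' hg d hd
  · rfl

variable {ord : CommutatorOrder X}

/-- The family is triangular in the degree. Once the coefficients in weights below d vanish, degree
d sees only the Lie values of the commutators of weight exactly d, which are independent. -/
theorem linearIndependent_truncatedMagnus [Finite X] {s N : ℕ} (hs : 1 ≤ s) (hN : N ≤ 2 * s) :
    LinearIndependent ℤ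
      (fun w : {w : FreeMagma X // IsBasic ord w ∧ s ≤ w.length ∧ w.length < N} =>
        (truncatedMagnus s N hs hN ⟨commutatorValue w.1,
          gamma_antitone w.2.2.1 (commutatorValue_mem_gamma w.1)⟩).toAdd) := by
  classical
  rw [linearIndependent_iff']
  intro T c hc
  suffices H : ∀ d, ∀ w ∈ T, w.1.length = d → c w = 0 from fun w hw => H _ w hw rfl
  intro d
  induction d using Nat.strong_induction_on with
  | _ d ih =>
  intro w hw hwd
  have hd := congrFun hc d
  rw [Finset.sum_apply, Pi.zero_apply] at hd
  have hdN : d < N := hwd ▸ w.2.2.2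
  have hterm : ∀ v ∈ T, (c v • (truncatedMagnus s N hs hN ⟨commutatorValue v.1,
      gamma_antitone v.2.2.1 (commutatorValue_mem_gamma v.1)⟩).toAdd) d =
        if v.1.length = d then c v • lieValue ℤ v.1 else 0 := by
    intro v hv
    have hval : (c v • (truncatedMagnus s N hs hN ⟨commutatorValue v.1,
      gamma_antitone v.2.2.1 (commutatorValue_mem_gamma v.1)⟩).toAdd) d =
        c v • coeff d (magnusSub (commutatorValue v.1)) := by
      simp [truncatedMagnus, hdN]
    rw [hval]
    split_ifs with h
    · subst h
      rw [(coeff_magnusSub_commutatorValue v.1).2]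
    · rcases lt_or_gt_of_ne h with h | h
      · rw [ih _ h v hv rfl, zero_smul]
      · rw [(coeff_magnusSub_commutatorValue v.1).1 d h, smul_zero]
  rw [Finset.sum_congr rfl hterm, ← Finset.sum_filter] at hd
  have hli := linearIndependent_int_lieValue (ord := ord) d
  rw [linearIndependent_iff'] at hli
  -- The default 0 never occurs, since s ≤ d < N.
  let f : {w : FreeMagma X // IsBasic ord w ∧ w.length = d} → ℤ := fun v =>
    if h : s ≤ v.1.length ∧ v.1.length < N then c ⟨v.1, v.2.1, h.1, h.2⟩ else 0
  have hsd : s ≤ d := hwd ▸ w.2.2.1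
  let T' : Finset {w : FreeMagma X // IsBasic ord w ∧ w.length = d} :=
    (T.filter (fun v => v.1.length = d)).attach.image
      (fun v => ⟨v.1.1, v.1.2.1, by have h := v.2; rw [Finset.mem_filter] at h; exact h.2⟩)
  have hsum : ∑ v ∈ T', f v • lieValue ℤ v.1 = 0 := by
    rw [Finset.sum_image, ← hd, ← Finset.sum_attach (T.filter _)]
    · refine Finset.sum_congr rfl fun v _ => ?_
      simp [f, v.1.2.2.1, v.1.2.2.2]
    · intro v _ v' _ h
      exact Subtype.ext (Subtype.ext (congrArg (fun x => x.1) h))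
  have := hli T' f hsum ⟨w.1, w.2.1, hwd⟩
    (Finset.mem_image.mpr ⟨⟨w, Finset.mem_filter.mpr ⟨hw, hwd⟩⟩, Finset.mem_attach _ _, rfl⟩)
  simpa [f, hwd, hsd, hdN] using this

end Magnus

/-! ### Verbal subgroups of outer commutator words -/

section Verbal

variable {F : Type u} [Group F]

theorem wordValue_commutator (f : ℕ → F) (v w : FreeGroup ℕ) :
    wordValue f ⁅v, w⁆ = ⁅wordValue f v, wordValue f w⁆ :=
  map_commutatorElement (FreeGroup.lift f) v w

theorem wordValue_gammaWord_succ (f : ℕ → F) (s c : ℕ) :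
    wordValue f (gammaWord s (c + 1)) = ⁅wordValue f (gammaWord s c), f (s + (c + 1))⁆ := by
  rw [gammaWord, wordValue_commutator]
  simp [wordValue]

theorem wordValue_congr_gammaWord {f g : ℕ → F} {s c : ℕ}
    (h : ∀ j, s ≤ j → j ≤ s + c → f j = g j) :
    wordValue f (gammaWord s c) = wordValue g (gammaWord s c) := by
  induction c with
  | zero => simpa [gammaWord, wordValue] using h s le_rfl le_rfl
  | succ c ih =>
    rw [wordValue_gammaWord_succ, wordValue_gammaWord_succ,
      ih fun j h₁ h₂ => h j h₁ (by omega), h _ (by omega) (by omega)]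

theorem wordValue_gammaWord_mem (f : ℕ → F) (s c : ℕ) :
    wordValue f (gammaWord s c) ∈ gamma F (c + 1) := by
  induction c with
  | zero => simp
  | succ c ih =>
    rw [wordValue_gammaWord_succ]
    exact commutator_mem_gamma (j := 1) ih (by simp) (by omega) le_rfl le_rfl

/-- The values of the word `γ_{c+1}` whose first argument lies in `R`. -/
def gammaValues (R : Subgroup F) (c : ℕ) : Set F :=
  {g | ∃ f : ℕ → F, f 0 ∈ R ∧ g = wordValue f (gammaWord 0 c)}

theorem wordValue_gammaWord_shift (f : ℕ → F) (s c : ℕ) :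
    wordValue f (gammaWord s c) = wordValue (fun j => f (s + j)) (gammaWord 0 c) := by
  induction c with
  | zero => simp [gammaWord, wordValue]
  | succ c ih => rw [wordValue_gammaWord_succ, wordValue_gammaWord_succ, ih, zero_add]

theorem conj_mem_gammaValues {R : Subgroup F} [hR : R.Normal] {c : ℕ} {g : F}
    (hg : g ∈ gammaValues R c) (x : F) : x * g * x⁻¹ ∈ gammaValues R c := by
  obtain ⟨f, hf, rfl⟩ := hg
  exact ⟨_, hR.conj_mem _ hf x, conj_wordValue x f _⟩

/-- Modulo Q the generators commute pairwise, and centralizers are subgroups. -/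
theorem commutator_closure_le {A B : Set F} {Q : Subgroup F} [Q.Normal]
    (h : ∀ a ∈ A, ∀ b ∈ B, ⁅a, b⁆ ∈ Q) : ⁅Subgroup.closure A, Subgroup.closure B⁆ ≤ Q := by
  have hmap : ∀ K : Subgroup F, K.map (QuotientGroup.mk' Q) = ⊥ ↔ K ≤ Q := fun K => by
    rw [Subgroup.map_eq_bot_iff, QuotientGroup.ker_mk']
  rw [← hmap, Subgroup.map_commutator, Subgroup.commutator_eq_bot_iff_le_centralizer,
    MonoidHom.map_closure, MonoidHom.map_closure, Subgroup.centralizer_closure,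
    Subgroup.closure_le]
  rintro _ ⟨a, ha, rfl⟩
  rw [SetLike.mem_coe, Subgroup.mem_centralizer_iff]
  rintro _ ⟨b, hb, rfl⟩
  rw [eq_comm, ← commutatorElement_eq_one_iff_mul_comm, ← map_commutatorElement,
    QuotientGroup.mk'_apply, QuotientGroup.eq_one_iff]
  exact h a ha b hb

theorem normal_closure_of_conj_mem {A : Set F} (h : ∀ a ∈ A, ∀ x, x * a * x⁻¹ ∈ A) :
    (Subgroup.closure A).Normal := by
  have : Subgroup.normalClosure A = Subgroup.closure A := by
    refine le_antisymm ?_ Subgroup.closure_le_normalClosure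
    rw [Subgroup.normalClosure]
    refine Subgroup.closure_mono fun g hg => ?_
    obtain ⟨a, ha, hag⟩ := Group.mem_conjugatesOfSet_iff.mp hg
    obtain ⟨x, rfl⟩ := isConj_iff.mp hag
    exact h a ha x
  rw [← this]
  infer_instance

/-- The values are closed under conjugation, so they generate a normal subgroup, and
`commutator_closure_le` reduces each induction step to appending one more argument to a value. The
case n = 0 describes γ_{c+1} itself. -/
theorem closure_gammaValues (n : ℕ) (c : ℕ) :
    Subgroup.closure (gammaValues (gamma F (n + 1)) c) = gamma F (n + c + 1) := by
  refine le_antisymm ((Subgroup.closure_le _).mpr ?_) ?_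
  · rintro _ ⟨f, hf, rfl⟩
    induction c with
    | zero => simpa [gammaWord, wordValue] using hf
    | succ c ih =>
      rw [wordValue_gammaWord_succ]
      exact commutator_mem_gamma (j := 1) ih (by simp) (by omega) le_rfl (by omega)
  · induction c with
    | zero =>
      intro g hg
      exact Subgroup.subset_closure ⟨fun _ => g, hg, by simp [gammaWord, wordValue]⟩
    | succ c ih =>
      have : (Subgroup.closure (gammaValues (gamma F (n + 1)) (c + 1))).Normal :=
        normal_closure_of_conj_mem fun a ha x => conj_mem_gammaValues ha x
      rw [show n + (c + 1) + 1 = n + c + 1 + 1 by ring, gamma_succ (by omega)]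
      refine (Subgroup.commutator_mono ih (Subgroup.closure_univ.ge)).trans
        (commutator_closure_le ?_)
      rintro _ ⟨f, hf, rfl⟩ y -
      refine Subgroup.subset_closure ⟨Function.update f (c + 1) y, ?_, ?_⟩
      · rwa [Function.update_of_ne (by omega)]
      · rw [wordValue_gammaWord_succ, zero_add, Function.update_self]
        congr 1
        refine wordValue_congr_gammaWord fun j _ hj => ?_
        rw [Function.update_of_ne (by omega)]

/-- The verbal subgroup of an outer commutator word `[γ_{c₁+1}, γ_{c₂+1}]`. -/
theorem verbalSubgroup_outerWord (c₁ c₂ : ℕ) :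
    verbalSubgroup {outerWord c₁ c₂} F = ⁅gamma F (c₁ + 1), gamma F (c₂ + 1)⁆ := by
  have hgen : ∀ c, gamma F (c + 1) = Subgroup.closure (gammaValues (gamma F 1) c) := fun c => by
    have := closure_gammaValues (F := F) 0 c
    rw [zero_add, zero_add] at this
    exact this.symm
  refine le_antisymm ((Subgroup.closure_le _).mpr ?_) ?_
  · rintro _ ⟨v, rfl, f, rfl⟩
    rw [outerWord, wordValue_commutator]
    exact Subgroup.commutator_mem_commutator (wordValue_gammaWord_mem _ _ _)
      (wordValue_gammaWord_mem _ _ _)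
  · have : (verbalSubgroup {outerWord c₁ c₂} F).Normal := by
      unfold verbalSubgroup
      refine normal_closure_of_conj_mem ?_
      rintro _ ⟨v, hv, f, rfl⟩ x
      exact ⟨v, hv, fun j => x * f j * x⁻¹, conj_wordValue x f v⟩
    rw [hgen c₁, hgen c₂]
    refine commutator_closure_le ?_
    rintro _ ⟨f, -, rfl⟩ _ ⟨g, -, rfl⟩
    refine Subgroup.subset_closure
      ⟨_, rfl, fun j => if j ≤ c₁ then f j else g (j - (c₁ + 1)), ?_⟩
    rw [outerWord, wordValue_commutator, wordValue_gammaWord_shift _ (c₁ + 1)]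
    congr 1
    · exact wordValue_congr_gammaWord fun j _ hj => by simp [show j ≤ c₁ by omega]
    · exact wordValue_congr_gammaWord fun j _ hj => by
        simp [show ¬ (c₁ + 1 + j ≤ c₁) by omega]

/-- In the step from [u, y] to [ut, yt'] the errors come from [t, yt'] and [u, t'], both of weight
at least c + n + 2. Letting both entries vary, possibly by 1, avoids asking where i lies. -/
theorem wordValue_gammaWord_update {n : ℕ} (s c : ℕ) (f : ℕ → F) (i : ℕ) {r : F}
    (hr : r ∈ gamma F (n + 1)) :
    ∃ t ∈ gamma F (c + n + 1), wordValue (Function.update f i (f i * r)) (gammaWord s c) =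
      wordValue f (gammaWord s c) * t := by
  have hupd : ∀ j, ∃ t ∈ gamma F (n + 1), Function.update f i (f i * r) j = f j * t := by
    intro j
    by_cases h : j = i
    · subst h
      exact ⟨r, hr, by simp⟩
    · exact ⟨1, Subgroup.one_mem _, by simp [h]⟩
  induction c with
  | zero =>
    obtain ⟨t, ht, h⟩ := hupd s
    exact ⟨t, by simpa using ht, by simpa [gammaWord, wordValue] using h⟩
  | succ c ih =>
    obtain ⟨t, ht, h⟩ := ih
    obtain ⟨t', ht', h'⟩ := hupd (s + (c + 1))
    rw [wordValue_gammaWord_succ, wordValue_gammaWord_succ, h, h']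
    set u := wordValue f (gammaWord s c)
    set y := f (s + (c + 1))
    have hN := gamma_normal F (c + 1 + n + 1)
    have h₁ : ⁅t, y * t'⁆ ∈ gamma F (c + 1 + n + 1) :=
      commutator_mem_gamma (j := 1) ht (by simp) (by omega) le_rfl (by omega)
    have h₂ : ⁅u, t'⁆ ∈ gamma F (c + 1 + n + 1) :=
      commutator_mem_gamma (wordValue_gammaWord_mem f s c) ht' (by omega) (by omega) (by omega)
    refine ⟨⁅u, y⁆⁻¹ * (u * ⁅t, y * t'⁆ * u⁻¹) * ⁅u, y⁆⁻¹⁻¹ * (y * ⁅u, t'⁆ * y⁻¹),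
      Subgroup.mul_mem _ (hN.conj_mem _ (hN.conj_mem _ h₁ _) _) (hN.conj_mem _ h₂ _), ?_⟩
    simp only [commutatorElement_def]
    group

theorem wordValue_gammaWord_eq_one {f : ℕ → F} {s : ℕ} (hf : f s = 1) (c : ℕ) :
    wordValue f (gammaWord s c) = 1 := by
  induction c with
  | zero => simpa [gammaWord, wordValue] using hf
  | succ c ih => rw [wordValue_gammaWord_succ, ih, commutatorElement_one_left]

/-- For `≤`, [ut, zt'][u, z]⁻¹ is a product of conjugates of [t, zt'] and [u, t']. For `≥`, the base
tuple has 1 as the first argument of one block, so its value is trivial; multiplying that argument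
by r produces an arbitrary commutator of generating values. -/
theorem verbalCommutator_outerWord (n c₁ c₂ : ℕ) :
    verbalCommutator {outerWord c₁ c₂} (gamma F (n + 1)) =
      ⁅gamma F (c₁ + n + 1), gamma F (c₂ + 1)⁆ ⊔ ⁅gamma F (c₂ + n + 1), gamma F (c₁ + 1)⁆ := by
  refine le_antisymm ((Subgroup.closure_le _).mpr ?_) (sup_le ?_ ?_)
  · rintro _ ⟨v, rfl, f, i, r, hr, rfl⟩
    rw [SetLike.mem_coe, outerWord, wordValue_commutator, wordValue_commutator]
    obtain ⟨t, ht, h⟩ := wordValue_gammaWord_update 0 c₁ f i hr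
    obtain ⟨t', ht', h'⟩ := wordValue_gammaWord_update (c₁ + 1) c₂ f i hr
    have hz' := wordValue_gammaWord_mem (Function.update f i (f i * r)) (c₁ + 1) c₂
    have hu := wordValue_gammaWord_mem f 0 c₁
    rw [h'] at hz'
    rw [h, h']
    generalize wordValue f (gammaWord 0 c₁) = u at *
    generalize wordValue f (gammaWord (c₁ + 1) c₂) = z at *
    have h₁ := Subgroup.commutator_mem_commutator ht hz'
    have h₂ := commutator_mem_swap (Subgroup.commutator_mem_commutator ht' hu)
    have hN : (⁅gamma F (c₁ + n + 1), gamma F (c₂ + 1)⁆ ⊔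
      ⁅gamma F (c₂ + n + 1), gamma F (c₁ + 1)⁆).Normal := inferInstance
    have : ⁅u * t, z * t'⁆ * ⁅u, z⁆⁻¹ =
        (u * ⁅t, z * t'⁆ * u⁻¹) * (⁅u, z⁆ * (z * ⁅u, t'⁆ * z⁻¹) * ⁅u, z⁆⁻¹) := by
      simp only [commutatorElement_def]
      group
    rw [this]
    refine Subgroup.mul_mem _ (hN.conj_mem _ (le_sup_left (α := Subgroup F) h₁) _)
      (hN.conj_mem _ (hN.conj_mem _ (le_sup_right (α := Subgroup F) ?_) _) _)
    exact h₂
  · have h₁ := closure_gammaValues (F := F) n c₁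
    have h₂ := closure_gammaValues (F := F) 0 c₂
    rw [zero_add, zero_add] at h₂
    rw [add_comm c₁ n, ← h₁, ← h₂]
    refine commutator_closure_le ?_
    rintro _ ⟨f, hf, rfl⟩ _ ⟨g, -, rfl⟩
    let f' : ℕ → F := fun j => if j = 0 then 1 else if j ≤ c₁ then f j else g (j - (c₁ + 1))
    have hone : wordValue f' (gammaWord 0 c₁) = 1 := wordValue_gammaWord_eq_one (by simp [f']) _
    refine Subgroup.subset_closure ⟨_, rfl, f', 0, f 0, hf, ?_⟩
    rw [outerWord, wordValue_commutator, wordValue_commutator, hone, commutatorElement_one_left,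
      inv_one, mul_one, wordValue_gammaWord_shift _ (c₁ + 1)]
    congr 1
    · refine wordValue_congr_gammaWord fun j _ hj => ?_
      by_cases h : j = 0
      · subst h
        simp [f']
      · simp [f', h, show j ≤ c₁ by omega]
    · exact wordValue_congr_gammaWord fun j _ hj => by
        simp [f', show ¬ (c₁ + 1 + j ≤ c₁) by omega]
  · have h₁ := closure_gammaValues (F := F) n c₂
    have h₂ := closure_gammaValues (F := F) 0 c₁
    rw [zero_add, zero_add] at h₂
    rw [Subgroup.commutator_comm, add_comm c₂ n, ← h₁, ← h₂]
    refine commutator_closure_le ?_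
    rintro _ ⟨f, -, rfl⟩ _ ⟨g, hg, rfl⟩
    let f' : ℕ → F := fun j => if j ≤ c₁ then f j else if j = c₁ + 1 then 1 else g (j - (c₁ + 1))
    have hone : wordValue f' (gammaWord (c₁ + 1) c₂) = 1 :=
      wordValue_gammaWord_eq_one (by simp [f']) _
    refine Subgroup.subset_closure ⟨_, rfl, f', c₁ + 1, g 0, hg, ?_⟩
    rw [outerWord, wordValue_commutator, wordValue_commutator, hone, commutatorElement_one_right,
      inv_one, mul_one, wordValue_gammaWord_shift _ (c₁ + 1)]
    congr 1
    · exact wordValue_congr_gammaWord fun j _ hj => by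
        simp [f', show j ≤ c₁ by omega, show j ≠ c₁ + 1 by omega]
    · refine wordValue_congr_gammaWord fun j _ hj => ?_
      by_cases h : j = 0
      · subst h
        simp [f']
      · simp [f', h, show ¬ (c₁ + 1 + j ≤ c₁) by omega]

end Verbal

/-! ### Independence of the free presentation -/

section Presentations

theorem exists_forall_wordValue_congr {F : Type u} [Group F] (v : FreeGroup ℕ) :
    ∃ M : ℕ, ∀ f g : ℕ → F, (∀ j < M, f j = g j) → wordValue f v = wordValue g v := by
  induction v using FreeGroup.induction_on with
  | C1 => exact ⟨0, fun f g _ => by simp [wordValue]⟩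
  | of x => exact ⟨x + 1, fun f g h => by simpa [wordValue] using h x (Nat.lt_succ_self x)⟩
  | inv_of x ih =>
    obtain ⟨M, hM⟩ := ih
    exact ⟨M, fun f g h => by simpa [wordValue] using hM f g h⟩
  | mul v w hv hw =>
    obtain ⟨M, hM⟩ := hv
    obtain ⟨M', hM'⟩ := hw
    refine ⟨max M M', fun f g h => ?_⟩
    have h₁ := hM f g fun j hj => h j (lt_max_of_lt_left hj)
    have h₂ := hM' f g fun j hj => h j (lt_max_of_lt_right hj)
    rw [wordValue, wordValue] at h₁ h₂ ⊢
    rw [map_mul, map_mul, h₁, h₂]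

variable {F : Type u} [Group F] {F' : Type v} [Group F']

/-- Telescoping: the arguments are changed one at a time, and finitely many changes suffice because
a word involves finitely many variables. -/
theorem wordValue_mul_mem {V : Set (FreeGroup ℕ)} {R : Subgroup F} {w : FreeGroup ℕ} (hw : w ∈ V)
    (f r : ℕ → F) (hr : ∀ j, r j ∈ R) :
    wordValue (fun j => f j * r j) w * (wordValue f w)⁻¹ ∈ verbalCommutator V R := by
  have key : ∀ k : ℕ, wordValue (fun j => if j < k then f j * r j else f j) w * (wordValue f w)⁻¹ ∈
      verbalCommutator V R := by
    intro k
    induction k with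
    | zero =>
      simp
    | succ k ih =>
      set f' : ℕ → F := fun j => if j < k then f j * r j else f j with hf'
      have hstep : wordValue (Function.update f' k (f' k * r k)) w * (wordValue f' w)⁻¹ ∈
          verbalCommutator V R := Subgroup.subset_closure ⟨w, hw, f', k, r k, hr k, rfl⟩
      have h := Subgroup.mul_mem _ hstep ih
      rw [← mul_assoc, inv_mul_cancel_right] at h
      convert h using 3
      funext j
      by_cases h₁ : j = k
      · subst h₁
        simp [hf']
      · simp [hf', h₁, show j < k + 1 ↔ j < k by omega]
  obtain ⟨M, hM⟩ := exists_forall_wordValue_congr (F := F) w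
  have h := key M
  rwa [hM _ (fun j => f j * r j) fun j hj => by simp [hj]] at h

/-- φ changes every argument of a word by an element of R, so φ and the identity agree modulo [RV*F]
on the generators of V(F). -/
theorem endomorphism_mul_inv_mem (V : Set (FreeGroup ℕ)) (R : Subgroup F) [R.Normal] (φ : F →* F)
    (hφ : ∀ g, g⁻¹ * φ g ∈ R) {g : F} (hg : g ∈ verbalSubgroup V F) :
    (φ g)⁻¹ * g ∈ verbalCommutator V R := by
  have : verbalSubgroup V F ≤ MonoidHom.eqLocus
      ((QuotientGroup.mk' (verbalCommutator V R)).comp φ)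
      (QuotientGroup.mk' (verbalCommutator V R)) := by
    refine (Subgroup.closure_le _).mpr ?_
    rintro _ ⟨v, hv, f, rfl⟩
    change QuotientGroup.mk' _ (φ (wordValue f v)) = QuotientGroup.mk' _ _
    rw [eq_comm, ← mul_inv_eq_one, ← map_inv, ← map_mul, QuotientGroup.mk'_apply,
      QuotientGroup.eq_one_iff, ← Subgroup.inv_mem_iff, mul_inv_rev, inv_inv]
    have hmap : φ (wordValue f v) = wordValue (fun j => f j * ((f j)⁻¹ * φ (f j))) v := by
      simp only [mul_inv_cancel_left]
      refine DFunLike.congr_fun (?_ : φ.comp (FreeGroup.lift f) = FreeGroup.lift _) v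
      ext j
      simp
    rw [hmap]
    exact wordValue_mul_mem hv f _ fun j => hφ _
  exact QuotientGroup.eq.mp (this hg)

theorem map_wordValue (φ : F →* F') (f : ℕ → F) (v : FreeGroup ℕ) :
    φ (wordValue f v) = wordValue (φ ∘ f) v := by
  refine DFunLike.congr_fun (?_ : φ.comp (FreeGroup.lift f) = FreeGroup.lift _) v
  ext j
  simp

theorem verbalSubgroup_le_comap (V : Set (FreeGroup ℕ)) (φ : F →* F') :
    verbalSubgroup V F ≤ (verbalSubgroup V F').comap φ := by
  refine (Subgroup.closure_le _).mpr ?_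
  rintro _ ⟨v, hv, f, rfl⟩
  exact Subgroup.subset_closure ⟨v, hv, _, map_wordValue φ f v⟩

theorem verbalCommutator_le_comap (V : Set (FreeGroup ℕ)) {R : Subgroup F} {R' : Subgroup F'}
    (φ : F →* F') (hφ : R ≤ R'.comap φ) :
    verbalCommutator V R ≤ (verbalCommutator V R').comap φ := by
  refine (Subgroup.closure_le _).mpr ?_
  rintro _ ⟨v, hv, f, i, r, hr, rfl⟩
  refine Subgroup.subset_closure ⟨v, hv, φ ∘ f, i, φ r, hφ hr, ?_⟩
  rw [map_mul, map_inv, map_wordValue, map_wordValue]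
  congr 2
  funext j
  by_cases h : j = i
  · subst h
    simp
  · simp [h]

/-- The map of Baer invariants induced by a map of presentations. -/
def baerMap (V : Set (FreeGroup ℕ)) {R : Subgroup F} {R' : Subgroup F'} [R.Normal] [R'.Normal]
    (φ : F →* F') (hφ : R ≤ R'.comap φ) : BaerInvariant V R →* BaerInvariant V R' :=
  QuotientGroup.map _ _
    ((φ.comp (R ⊓ verbalSubgroup V F).subtype).codRestrict (R' ⊓ verbalSubgroup V F')
      fun g => ⟨hφ g.2.1, verbalSubgroup_le_comap V φ g.2.2⟩)
    fun _ hg => verbalCommutator_le_comap V φ hφ hg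

theorem baerMap_comp_baerMap (V : Set (FreeGroup ℕ)) {R : Subgroup F} {R' : Subgroup F'} [R.Normal]
    [R'.Normal] (φ : F →* F') (hφ : R ≤ R'.comap φ) (ψ : F' →* F) (hψ : R' ≤ R.comap ψ)
    (h : ∀ g, g⁻¹ * ψ (φ g) ∈ R) (q : BaerInvariant V R) :
    baerMap V ψ hψ (baerMap V φ hφ q) = q := by
  obtain ⟨g, rfl⟩ := QuotientGroup.mk_surjective q
  exact QuotientGroup.eq.mpr (endomorphism_mul_inv_mem V R (ψ.comp φ) h g.2.2)

/-- Baer invariants do not depend on the free presentation. -/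
theorem nonempty_baerInvariant_mulEquiv (V : Set (FreeGroup ℕ)) {X : Type u} {Y : Type v}
    {G : Type*} [Group G] (π : FreeGroup X →* G) (hπ : Function.Surjective π)
    (π' : FreeGroup Y →* G) (hπ' : Function.Surjective π') :
    Nonempty (BaerInvariant V π.ker ≃* BaerInvariant V π'.ker) := by
  choose s hs using hπ
  choose s' hs' using hπ'
  -- Freeness lifts the identity of G in both directions; each composite is congruent to the
  -- identity modulo the corresponding kernel.
  let φ : FreeGroup X →* FreeGroup Y := FreeGroup.lift fun x => s' (π (FreeGroup.of x))
  let ψ : FreeGroup Y →* FreeGroup X := FreeGroup.lift fun y => s (π' (FreeGroup.of y))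
  have hφ : ∀ g, π' (φ g) = π g := fun g =>
    DFunLike.congr_fun (show π'.comp φ = π by ext x; simp [φ, hs']) g
  have hψ : ∀ g, π (ψ g) = π' g := fun g =>
    DFunLike.congr_fun (show π.comp ψ = π' by ext x; simp [ψ, hs]) g
  have hφker : π.ker ≤ π'.ker.comap φ := fun g hg => by
    rw [Subgroup.mem_comap, MonoidHom.mem_ker, hφ]
    exact hg
  have hψker : π'.ker ≤ π.ker.comap ψ := fun g hg => by
    rw [Subgroup.mem_comap, MonoidHom.mem_ker, hψ]
    exact hg
  refine ⟨(baerMap V φ hφker).toMulEquiv (baerMap V ψ hψker) (MonoidHom.ext ?_)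
    (MonoidHom.ext ?_)⟩
  · exact baerMap_comp_baerMap V φ hφker ψ hψker fun g => by
      rw [MonoidHom.mem_ker, map_mul, map_inv, hψ, hφ, inv_mul_cancel]
  · exact baerMap_comp_baerMap V ψ hψker φ hφker fun g => by
      rw [MonoidHom.mem_ker, map_mul, map_inv, hφ, hψ, inv_mul_cancel]

end Presentations

/-! ### A criterion for a free abelian basis -/

section FreeAbelian

/-- The free abelian group on ι maps onto Q by generation; followed by Φ this is the map of linear
combinations of an independent family, so it is also injective. -/
theorem isFreeAbelianWithBasis_of_linearIndependent {Q : Type u} [Group Q]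
    (hcomm : ∀ x y : Q, x * y = y * x) {ι : Type v} (b : ι → Q)
    (hgen : Subgroup.closure (Set.range b) = ⊤) {M : Type*} [AddCommGroup M] [inst : Module ℤ M]
    (Φ : Q →* Multiplicative M) (hli : LinearIndependent ℤ fun i => (Φ (b i)).toAdd) :
    IsFreeAbelianWithBasis b := by
  obtain rfl : inst = AddCommGroup.toIntModule M := Subsingleton.elim _ _
  let _ : CommGroup Q := { (inferInstance : Group Q) with mul_comm := hcomm }
  let f : FreeAbelianGroup ι →+ Additive Q := FreeAbelianGroup.lift fun i => Additive.ofMul (b i)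
  let e : Multiplicative (FreeAbelianGroup ι) →* Q := AddMonoidHom.toMultiplicativeLeft f
  have he : ∀ i, e (Multiplicative.ofAdd (FreeAbelianGroup.of i)) = b i := fun i => by
    simp [e, f]
  have hsurj : Function.Surjective e := by
    rw [← MonoidHom.range_eq_top, eq_top_iff, ← hgen, Subgroup.closure_le]
    rintro _ ⟨i, rfl⟩
    exact ⟨_, he i⟩
  have hcomp : ∀ x : FreeAbelianGroup ι, (Φ (e (Multiplicative.ofAdd x))).toAdd =
      Finsupp.linearCombination ℤ (fun i => (Φ (b i)).toAdd) (FreeAbelianGroup.toFinsupp x) := by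
    intro x
    refine DFunLike.congr_fun (FreeAbelianGroup.lift_ext
      (AddMonoidHom.toMultiplicative.symm (Φ.comp e))
      ((Finsupp.linearCombination ℤ (fun i => (Φ (b i)).toAdd)).toAddMonoidHom.comp
        FreeAbelianGroup.toFinsupp) fun i => ?_) x
    simp [he]
  have hinj : Function.Injective e := by
    rw [injective_iff_map_eq_one]
    intro x hx
    have h₁ := hcomp x.toAdd
    rw [ofAdd_toAdd, hx, map_one, toAdd_one, eq_comm] at h₁
    have h₂ := (linearIndependent_iff.mp hli) _ h₁
    have h₃ : x.toAdd = 0 := by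
      rw [← Finsupp.toFreeAbelianGroup_toFinsupp x.toAdd, h₂, map_zero]
    exact h₃
  exact ⟨MulEquiv.ofBijective e ⟨hinj, hsurj⟩, he⟩

end FreeAbelian

/-! ### The basis of the Baer invariant -/

section MainResult

variable {X : Type u} {ord : CommutatorOrder X}

/-- If β = [b₁, b₂] with b₂ > α, then b₁ and b₂ both weigh at least as much as α, so β weighs at
least twice as much. -/
theorem isBasic_mul_of_length_lt {β α : FreeMagma X} (hβ : IsBasic ord β) (hα : IsBasic ord α)
    (hlt : ord.lt α β) (h : β.length < 2 * α.length) : IsBasic ord (β * α) := by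
  refine .comm _ _ hβ hα hlt ?_
  rintro b₁ b₂ rfl
  obtain ⟨-, -, hlt', -⟩ := (isBasic_mul_iff ord).mp hβ
  rcases order_trichotomy (ord := ord) b₂ α with h' | h' | h'
  · exact Or.inr h'
  · exact Or.inl h'
  · have h₁ := length_le_of_order hlt'
    have h₂ := length_le_of_order h'
    rw [length_mul] at h
    omega

theorem mul_mem_setA {n c₁ c₂ : ℕ} {β α : FreeMagma X} : β * α ∈ setA ord n c₁ c₂ ↔
    IsBasic ord β ∧ IsBasic ord α ∧ ord.lt α β ∧
      c₁ + 1 ≤ β.length ∧ β.length ≤ c₁ + n ∧ c₂ + 1 ≤ α.length ∧ α.length ≤ c₂ + n := by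
  constructor
  · rintro ⟨β', α', h₁, h₂, h₃, h₄, h₅, h₆, h₇, h⟩
    obtain ⟨rfl, rfl⟩ := mul_inj.mp h
    exact ⟨h₁, h₂, h₃, h₄, h₅, h₆, h₇⟩
  · rintro ⟨h₁, h₂, h₃, h₄, h₅, h₆, h₇⟩
    exact ⟨β, α, h₁, h₂, h₃, h₄, h₅, h₆, h₇, rfl⟩

theorem mul_mem_setC {n c₁ c₂ : ℕ} {β α : FreeMagma X} : β * α ∈ setC ord n c₁ c₂ ↔
    IsBasic ord β ∧ IsBasic ord α ∧ ord.lt α β ∧ c₂ + n + 1 ≤ β.length ∧ c₁ + 1 ≤ α.length ∧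
      β.length + α.length ≤ 2 * n + c₁ + c₂ + 1 := by
  constructor
  · rintro ⟨β', α', h₁, h₂, h₃, h₄, h₅, h₆, h⟩
    obtain ⟨rfl, rfl⟩ := mul_inj.mp h
    exact ⟨h₁, h₂, h₃, h₄, h₅, h₆⟩
  · rintro ⟨h₁, h₂, h₃, h₄, h₅, h₆⟩
    exact ⟨β, α, h₁, h₂, h₃, h₄, h₅, h₆, rfl⟩

variable {n c₁ c₂ : ℕ}

theorem isBasic_of_mem_setA (hn : 2 * n + c₁ < 2 * c₂ + 2) {w : FreeMagma X}
    (hw : w ∈ setA ord n c₁ c₂) : IsBasic ord w := by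
  obtain ⟨β, α, h₁, h₂, h₃, h₄, h₅, h₆, h₇, rfl⟩ := hw
  exact isBasic_mul_of_length_lt h₁ h₂ h₃ (by omega)

theorem length_of_mem_setA {w : FreeMagma X} (hw : w ∈ setA ord n c₁ c₂) :
    c₁ + c₂ + 2 ≤ w.length ∧ w.length < c₁ + c₂ + 2 * n + 2 := by
  obtain ⟨β, α, h₁, h₂, h₃, h₄, h₅, h₆, h₇, rfl⟩ := hw
  rw [length_mul]
  omega

theorem commutatorValue_mem_of_mem_setA {w : FreeMagma X} (hw : w ∈ setA ord n c₁ c₂) :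
    commutatorValue w ∈ ⁅gamma (FreeGroup X) (c₁ + 1), gamma (FreeGroup X) (c₂ + 1)⁆ := by
  obtain ⟨β, α, h₁, h₂, h₃, h₄, h₅, h₆, h₇, rfl⟩ := hw
  exact Subgroup.commutator_mem_commutator (gamma_antitone h₄ (commutatorValue_mem_gamma β))
    (gamma_antitone h₆ (commutatorValue_mem_gamma α))

theorem commutator_commutator_gamma_le {i j k l : ℕ} (hi : 1 ≤ i) (hj : 1 ≤ j) (hk : 1 ≤ k)
    (hl : l ≤ i + (j + k)) {F : Type*} [Group F] :
    ⁅gamma F i, ⁅gamma F j, gamma F k⁆⁆ ≤ gamma F l :=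
  (Subgroup.commutator_mono le_rfl (commutator_gamma_le j k hj hk)).trans
    ((commutator_gamma_le i (j + k) hi (by omega)).trans (gamma_antitone hl))

/-- The denominator `[γ_{c₁+n+1}, γ_{c₂+1}] [γ_{c₂+n+1}, γ_{c₁+1}]` of the Baer invariant. -/
abbrev baerDenominator (F : Type u) [Group F] (n c₁ c₂ : ℕ) : Subgroup F :=
  ⁅gamma F (c₁ + n + 1), gamma F (c₂ + 1)⁆ ⊔ ⁅gamma F (c₂ + n + 1), gamma F (c₁ + 1)⁆

theorem commutator_mem_baerDenominator {F : Type u} [Group F] {x y : F}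
    (hx : x ∈ gamma F (c₁ + 1)) (hy : y ∈ gamma F (c₂ + n + 1)) :
    ⁅x, y⁆ ∈ baerDenominator F n c₁ c₂ :=
  le_sup_right (α := Subgroup F)
    (commutator_mem_swap (Subgroup.commutator_mem_commutator hy hx))

/-- Modulo H both entries matter only up to γ_{c₁+n+1} and γ_{c₂+n+1}. The triple commutators lie in
H because γ_{c₁+c₂+2} is contained in both of these. -/
theorem commutator_gamma_le_closure [Finite X] (hc : c₂ ≤ c₁) (hn : 2 * n + c₁ < 2 * c₂ + 2) :
    ⁅gamma (FreeGroup X) (c₁ + 1), gamma (FreeGroup X) (c₂ + 1)⁆ ≤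
      Subgroup.closure (commutatorValue '' (setA ord n c₁ c₂ \ setC ord n c₁ c₂)) ⊔
        baerDenominator (FreeGroup X) n c₁ c₂ := by
  refine commutator_le_of_generators (K := baerDenominator (FreeGroup X) n c₁ c₂)
    le_sup_right
    (gamma_le_closure_basicValues (ord := ord) (j := c₁ + n + 1) (by omega) (by omega))
    basicValues_subset (gamma_antitone (by omega))
    (gamma_le_closure_basicValues (ord := ord) (j := c₂ + n + 1) (by omega) (by omega))
    basicValues_subset (gamma_antitone (by omega)) le_sup_left ?_ ?_ ?_ ?_
  · rw [Subgroup.commutator_comm]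
    exact le_sup_right
  · refine le_trans ?_ le_sup_right
    rw [Subgroup.commutator_comm]
    exact Subgroup.commutator_mono ((commutator_gamma_le _ _ (by omega) (by omega)).trans
      (gamma_antitone (by omega))) le_rfl
  · refine le_trans ?_ le_sup_left
    rw [Subgroup.commutator_comm]
    exact Subgroup.commutator_mono ((commutator_gamma_le _ _ (by omega) (by omega)).trans
      (gamma_antitone (by omega))) le_rfl
  · have key : ∀ β α : FreeMagma X, β * α ∈ setA ord n c₁ c₂ →
        ⁅commutatorValue β, commutatorValue α⁆ ∈
          Subgroup.closure (commutatorValue '' (setA ord n c₁ c₂ \ setC ord n c₁ c₂)) ⊔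
            baerDenominator (FreeGroup X) n c₁ c₂ := by
      intro β α hA
      by_cases hC : β * α ∈ setC ord n c₁ c₂
      · obtain ⟨-, -, -, h₁, h₂, -⟩ := mul_mem_setC.mp hC
        refine le_sup_right (α := Subgroup (FreeGroup X)) (le_sup_right
          (α := Subgroup (FreeGroup X)) (Subgroup.commutator_mem_commutator
            (gamma_antitone h₁ (commutatorValue_mem_gamma β))
            (gamma_antitone h₂ (commutatorValue_mem_gamma α))))
      · exact le_sup_left (α := Subgroup (FreeGroup X))
          (Subgroup.subset_closure ⟨β * α, ⟨hA, hC⟩, rfl⟩)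
    rintro _ ⟨β, ⟨hβ, h₁, h₂⟩, rfl⟩ _ ⟨α, ⟨hα, h₃, h₄⟩, rfl⟩
    rcases order_trichotomy (ord := ord) α β with h | rfl | h
    · exact key β α (mul_mem_setA.mpr ⟨hβ, hα, h, by omega⟩)
    · rw [commutatorElement_self]
      exact Subgroup.one_mem _
    -- Here c₁ + 1 ≤ wt β ≤ wt α ≤ c₂ + n, and c₂ ≤ c₁ puts the reversed pair in A.
    · have := length_le_of_order h
      exact commutator_mem_swap (key α β (mul_mem_setA.mpr ⟨hα, hβ, h, by omega⟩))

/-- The cut-offs are chosen so that discarded entries give weight at least N = c₁ + c₂ + 2n + 2. In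
the first factor wt β ≤ c₁ + 2n < 2(c₂ + 1), exactly the hypothesis, so [β, α] is basic; it is
outside A since wt β > c₁ + n. In the second factor [β, α] is in C when β > α, and otherwise [α, β]
is outside A because its second entry is too heavy. -/
theorem baerDenominator_le_closure [Finite X] (hc : c₂ ≤ c₁) (hn : 2 * n + c₁ < 2 * c₂ + 2) :
    baerDenominator (FreeGroup X) n c₁ c₂ ≤
      Subgroup.closure (commutatorValue '' {w | (IsBasic ord w ∧ c₁ + c₂ + 2 ≤ w.length ∧
        w.length < c₁ + c₂ + 2 * n + 2) ∧ w ∉ setA ord n c₁ c₂ \ setC ord n c₁ c₂}) ⊔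
        gamma (FreeGroup X) (c₁ + c₂ + 2 * n + 2) := by
  set Q := Subgroup.closure (commutatorValue '' {w | (IsBasic ord w ∧ c₁ + c₂ + 2 ≤ w.length ∧
    w.length < c₁ + c₂ + 2 * n + 2) ∧ w ∉ setA ord n c₁ c₂ \ setC ord n c₁ c₂}) ⊔
      gamma (FreeGroup X) (c₁ + c₂ + 2 * n + 2)
  have hlarge : ∀ β α : FreeMagma X, c₁ + c₂ + 2 * n + 2 ≤ β.length + α.length →
      ⁅commutatorValue β, commutatorValue α⁆ ∈ Q := fun β α h =>
    le_sup_right (α := Subgroup (FreeGroup X)) (commutator_mem_gamma (commutatorValue_mem_gamma β)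
      (commutatorValue_mem_gamma α) β.length_pos α.length_pos h)
  have hsmall : ∀ β α : FreeMagma X, IsBasic ord (β * α) →
      c₁ + c₂ + 2 ≤ β.length + α.length → β.length + α.length < c₁ + c₂ + 2 * n + 2 →
      β * α ∉ setA ord n c₁ c₂ \ setC ord n c₁ c₂ →
      ⁅commutatorValue β, commutatorValue α⁆ ∈ Q := fun β α h₁ h₂ h₃ h₄ =>
    le_sup_left (α := Subgroup (FreeGroup X))
      (Subgroup.subset_closure ⟨β * α, ⟨⟨h₁, h₂, h₃⟩, h₄⟩, rfl⟩)
  refine sup_le ?_ ?_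
  · refine commutator_le_of_generators (K := gamma (FreeGroup X) (c₁ + c₂ + 2 * n + 2))
      le_sup_right
      (gamma_le_closure_basicValues (ord := ord) (j := c₁ + 2 * n + 1) (by omega) (by omega))
      basicValues_subset (gamma_antitone (by omega))
      (gamma_le_closure_basicValues (ord := ord) (j := c₂ + n + 1) (by omega) (by omega))
      basicValues_subset (gamma_antitone (by omega))
      ((commutator_gamma_le _ _ (by omega) (by omega)).trans (gamma_antitone (by omega)))
      ((commutator_gamma_le _ _ (by omega) (by omega)).trans (gamma_antitone (by omega)))
      (commutator_commutator_gamma_le (by omega) (by omega) (by omega) (by omega))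
      (commutator_commutator_gamma_le (by omega) (by omega) (by omega) (by omega)) ?_
    rintro _ ⟨β, ⟨hβ, h₁, h₂⟩, rfl⟩ _ ⟨α, ⟨hα, h₃, h₄⟩, rfl⟩
    rcases le_or_gt (c₁ + c₂ + 2 * n + 2) (β.length + α.length) with hN | hN
    · exact hlarge β α hN
    rcases order_trichotomy (ord := ord) α β with h | rfl | h
    · refine hsmall β α (isBasic_mul_of_length_lt hβ hα h (by omega)) (by omega) hN fun hA => ?_
      obtain ⟨-, -, -, -, h', -⟩ := mul_mem_setA.mp hA.1
      omega
    · rw [commutatorElement_self]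
      exact Subgroup.one_mem _
    · have := length_le_of_order h
      omega
  · refine commutator_le_of_generators (K := gamma (FreeGroup X) (c₁ + c₂ + 2 * n + 2))
      le_sup_right
      (gamma_le_closure_basicValues (ord := ord) (j := c₂ + 2 * n + 1) (by omega) (by omega))
      basicValues_subset (gamma_antitone (by omega))
      (gamma_le_closure_basicValues (ord := ord) (j := c₁ + n + 1) (by omega) (by omega))
      basicValues_subset (gamma_antitone (by omega))
      ((commutator_gamma_le _ _ (by omega) (by omega)).trans (gamma_antitone (by omega)))
      ((commutator_gamma_le _ _ (by omega) (by omega)).trans (gamma_antitone (by omega)))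
      (commutator_commutator_gamma_le (by omega) (by omega) (by omega) (by omega))
      (commutator_commutator_gamma_le (by omega) (by omega) (by omega) (by omega)) ?_
    rintro _ ⟨β, ⟨hβ, h₁, h₂⟩, rfl⟩ _ ⟨α, ⟨hα, h₃, h₄⟩, rfl⟩
    rcases le_or_gt (c₁ + c₂ + 2 * n + 2) (β.length + α.length) with hN | hN
    · exact hlarge β α hN
    rcases order_trichotomy (ord := ord) α β with h | rfl | h
    · refine hsmall β α (isBasic_mul_of_length_lt hβ hα h (by omega)) (by omega) hN fun hA => ?_
      exact hA.2 (mul_mem_setC.mpr ⟨hβ, hα, h, by omega⟩)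
    · rw [commutatorElement_self]
      exact Subgroup.one_mem _
    · refine commutator_mem_swap (hsmall α β (isBasic_mul_of_length_lt hα hβ h (by omega))
        (by omega) (by omega) fun hA => ?_)
      obtain ⟨-, -, -, -, -, -, h'⟩ := mul_mem_setA.mp hA.1
      omega

theorem gamma_inf_verbalSubgroup {F : Type u} [Group F] (h : n + 1 ≤ c₁ + c₂ + 2) :
    gamma F (n + 1) ⊓ verbalSubgroup {outerWord c₁ c₂} F =
      ⁅gamma F (c₁ + 1), gamma F (c₂ + 1)⁆ := by
  rw [verbalSubgroup_outerWord, inf_eq_right]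
  exact (commutator_gamma_le _ _ (by omega) (by omega)).trans (gamma_antitone (by omega))

theorem isFreeAbelianWithBasis_setA_diff_setC [Finite X] (hc : c₂ ≤ c₁)
    (hn : 2 * n + c₁ < 2 * c₂ + 2)
    (hD : ∀ w ∈ setA ord n c₁ c₂ \ setC ord n c₁ c₂, commutatorValue w ∈
      gamma (FreeGroup X) (n + 1) ⊓ verbalSubgroup {outerWord c₁ c₂} (FreeGroup X)) :
    IsFreeAbelianWithBasis (fun w : ↥(setA ord n c₁ c₂ \ setC ord n c₁ c₂) =>
      (QuotientGroup.mk ⟨commutatorValue w.1, hD w.1 w.2⟩ :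
        BaerInvariant {outerWord c₁ c₂} (gamma (FreeGroup X) (n + 1)))) := by
  have hnum : gamma (FreeGroup X) (n + 1) ⊓ verbalSubgroup {outerWord c₁ c₂} (FreeGroup X) =
    ⁅gamma (FreeGroup X) (c₁ + 1), gamma (FreeGroup X) (c₂ + 1)⁆ :=
      gamma_inf_verbalSubgroup (by omega)
  have hden : verbalCommutator {outerWord c₁ c₂} (gamma (FreeGroup X) (n + 1)) =
    baerDenominator (FreeGroup X) n c₁ c₂ := verbalCommutator_outerWord n c₁ c₂
  have hle : gamma (FreeGroup X) (n + 1) ⊓ verbalSubgroup {outerWord c₁ c₂} (FreeGroup X) ≤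
      gamma (FreeGroup X) (c₁ + c₂ + 2) := by
    rw [hnum]
    exact (commutator_gamma_le _ _ (by omega) (by omega)).trans (gamma_antitone (by omega))
  have hs : 1 ≤ c₁ + c₂ + 2 := by omega
  have hN : c₁ + c₂ + 2 * n + 2 ≤ 2 * (c₁ + c₂ + 2) := by omega
  let D := {w : FreeMagma X // IsBasic ord w ∧ c₁ + c₂ + 2 ≤ w.length ∧
    w.length < c₁ + c₂ + 2 * n + 2}
  let lam := truncatedMagnus (X := X) (c₁ + c₂ + 2) (c₁ + c₂ + 2 * n + 2) hs hN
  let v : D → (ℕ → FreeAlgebra ℤ X) := fun w => (lam ⟨commutatorValue w.1,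
    gamma_antitone w.2.2.1 (commutatorValue_mem_gamma w.1)⟩).toAdd
  have hv : LinearIndependent ℤ v := linearIndependent_truncatedMagnus hs hN
  -- Dividing by the span of the basic commutators outside A \ C makes the expansion trivial on H.
  let S : Submodule ℤ (ℕ → FreeAlgebra ℤ X) :=
    Submodule.span ℤ (v '' {w | w.1 ∉ setA ord n c₁ c₂ \ setC ord n c₁ c₂})
  let Φ₀ : gamma (FreeGroup X) (c₁ + c₂ + 2) →* Multiplicative ((ℕ → FreeAlgebra ℤ X) ⧸ S) :=
    (AddMonoidHom.toMultiplicative S.mkQ.toAddMonoidHom).comp lam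
  have hker : baerDenominator (FreeGroup X) n c₁ c₂ ≤ Φ₀.ker.map (Subgroup.subtype _) := by
    refine (baerDenominator_le_closure (ord := ord) hc hn).trans
      (sup_le ((Subgroup.closure_le _).mpr ?_) fun g hg => ?_)
    · rintro _ ⟨w, ⟨hw, hwA⟩, rfl⟩
      refine ⟨⟨commutatorValue w, gamma_antitone hw.2.1 (commutatorValue_mem_gamma w)⟩, ?_, rfl⟩
      exact (Submodule.Quotient.mk_eq_zero S).mpr (Submodule.subset_span ⟨⟨w, hw⟩, hwA, rfl⟩)
    · refine ⟨⟨g, gamma_antitone (by omega) hg⟩, ?_, rfl⟩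
      rw [SetLike.mem_coe, MonoidHom.mem_ker, MonoidHom.comp_apply,
        truncatedMagnus_eq_one hs hN (by omega) _ hg, map_one]
  let Φ : BaerInvariant {outerWord c₁ c₂} (gamma (FreeGroup X) (n + 1)) →*
      Multiplicative ((ℕ → FreeAlgebra ℤ X) ⧸ S) :=
    QuotientGroup.lift _ (Φ₀.comp (Subgroup.inclusion hle)) (by
      intro g hg
      rw [Subgroup.mem_subgroupOf, hden] at hg
      obtain ⟨g', hg', hgg⟩ := hker hg
      rw [MonoidHom.mem_ker, MonoidHom.comp_apply, show Subgroup.inclusion hle g = g' from Subtype.ext hgg.symm]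
      exact hg')
  refine isFreeAbelianWithBasis_of_linearIndependent ?_ _ ?_ Φ ?_
  · intro x y
    obtain ⟨x, rfl⟩ := QuotientGroup.mk_surjective x
    obtain ⟨y, rfl⟩ := QuotientGroup.mk_surjective y
    rw [← QuotientGroup.mk_mul, ← QuotientGroup.mk_mul, eq_comm, QuotientGroup.eq,
      Subgroup.mem_subgroupOf, hden]
    have : (((y * x)⁻¹ * (x * y) : ↥(gamma (FreeGroup X) (n + 1) ⊓
        verbalSubgroup {outerWord c₁ c₂} (FreeGroup X))) : FreeGroup X) =
          ⁅(x : FreeGroup X)⁻¹, (y : FreeGroup X)⁻¹⁆ := by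
      simp [commutatorElement_def, mul_assoc]
    rw [this]
    -- The numerator lies in both γ_{c₁+1} and γ_{c₂+n+1}, so its commutators lie in H.
    exact commutator_mem_baerDenominator
      (gamma_antitone (by omega) (Subgroup.inv_mem _ (hle x.2)))
      (gamma_antitone (by omega) (Subgroup.inv_mem _ (hle y.2)))
  · set T := Subgroup.closure (Set.range fun w : ↥(setA ord n c₁ c₂ \ setC ord n c₁ c₂) =>
      (QuotientGroup.mk ⟨commutatorValue w.1, hD w.1 w.2⟩ :
        BaerInvariant {outerWord c₁ c₂} (gamma (FreeGroup X) (n + 1)))) with hT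
    have hgen : gamma (FreeGroup X) (n + 1) ⊓ verbalSubgroup {outerWord c₁ c₂} (FreeGroup X) ≤
        (T.comap (QuotientGroup.mk' _)).map (Subgroup.subtype _) := by
      refine hnum.le.trans ((commutator_gamma_le_closure (ord := ord) hc hn).trans
        (sup_le ((Subgroup.closure_le _).mpr ?_) fun g hg => ?_))
      · rintro _ ⟨w, hw, rfl⟩
        exact ⟨⟨commutatorValue w, hD w hw⟩, Subgroup.subset_closure ⟨⟨w, hw⟩, rfl⟩, rfl⟩
      · have hg' : g ∈ gamma (FreeGroup X) (n + 1) ⊓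
            verbalSubgroup {outerWord c₁ c₂} (FreeGroup X) := by
          rw [hnum]
          refine (sup_le (Subgroup.commutator_mono (gamma_antitone (by omega)) le_rfl) ?_ :
            baerDenominator (FreeGroup X) n c₁ c₂ ≤ _) hg
          rw [Subgroup.commutator_comm]
          exact Subgroup.commutator_mono le_rfl (gamma_antitone (by omega))
        refine ⟨⟨g, hg'⟩, ?_, rfl⟩
        have h1 : QuotientGroup.mk' ((verbalCommutator {outerWord c₁ c₂}
            (gamma (FreeGroup X) (n + 1))).subgroupOf _) ⟨g, hg'⟩ = 1 := by
          rw [QuotientGroup.mk'_apply, QuotientGroup.eq_one_iff, Subgroup.mem_subgroupOf, hden]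
          exact hg
        rw [SetLike.mem_coe, Subgroup.mem_comap, h1]
        exact Subgroup.one_mem _
    rw [eq_top_iff]
    rintro q -
    obtain ⟨g, rfl⟩ := QuotientGroup.mk_surjective q
    obtain ⟨g', hg', hgg⟩ := hgen g.2
    obtain rfl : g' = g := Subtype.ext hgg
    exact hg'
  · let j : ↥(setA ord n c₁ c₂ \ setC ord n c₁ c₂) → D := fun w =>
      ⟨w.1, isBasic_of_mem_setA hn w.2.1, length_of_mem_setA w.2.1⟩
    have hj : Function.Injective j := fun w w' h => Subtype.ext (congrArg (fun d => d.1) h)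
    -- Disjoint parts of an independent family have disjoint spans, so A \ C stays independent
    -- modulo S.
    have hdisj : Disjoint (Submodule.span ℤ (Set.range (v ∘ j))) (LinearMap.ker S.mkQ) := by
      rw [Submodule.ker_mkQ, Set.range_comp]
      refine hv.disjoint_span_image (Set.disjoint_left.mpr ?_)
      rintro _ ⟨w, rfl⟩ h
      exact h w.2
    have hli := (hv.comp j hj).map hdisj
    have hΦ : (fun w : ↥(setA ord n c₁ c₂ \ setC ord n c₁ c₂) =>
        (Φ (QuotientGroup.mk ⟨commutatorValue w.1, hD w.1 w.2⟩)).toAdd) = S.mkQ ∘ (v ∘ j) := rfl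
    rw [hΦ]
    exact hli

end MainResult

end BaerNilp

theorem theorem2p8 (m n c₁ c₂ : ℕ) (hc : c₂ ≤ c₁)
    (hn : 2 * (n : ℤ) - 2 < 2 * (c₂ : ℤ) - (c₁ : ℤ))
    (ord : CommutatorOrder (Fin m)) :
    -- numerator and denominator of the Baer invariant of `G = F / R`, `R = γ_{n+1}(F)`
    gamma (FreeGroup (Fin m)) (n + 1) ⊓
        verbalSubgroup {outerWord c₁ c₂} (FreeGroup (Fin m)) =
      ⁅gamma (FreeGroup (Fin m)) (c₁ + 1), gamma (FreeGroup (Fin m)) (c₂ + 1)⁆ ∧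
    verbalCommutator {outerWord c₁ c₂} (gamma (FreeGroup (Fin m)) (n + 1)) =
      ⁅gamma (FreeGroup (Fin m)) (c₁ + n + 1), gamma (FreeGroup (Fin m)) (c₂ + 1)⁆ ⊔
        ⁅gamma (FreeGroup (Fin m)) (c₂ + n + 1), gamma (FreeGroup (Fin m)) (c₁ + 1)⁆ ∧
    -- the cosets of the basic commutators in `A \ C` form a basis of the Baer invariant
    (∀ w ∈ setA ord n c₁ c₂ \ setC ord n c₁ c₂, IsBasic ord w) ∧
    (∃ hD : ∀ w ∈ setA ord n c₁ c₂ \ setC ord n c₁ c₂,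
        commutatorValue w ∈ gamma (FreeGroup (Fin m)) (n + 1) ⊓
          verbalSubgroup {outerWord c₁ c₂} (FreeGroup (Fin m)),
      IsFreeAbelianWithBasis
        (fun w : ↥(setA ord n c₁ c₂ \ setC ord n c₁ c₂) =>
          (QuotientGroup.mk ⟨commutatorValue w.1, hD w.1 w.2⟩ :
            BaerInvariant {outerWord c₁ c₂} (gamma (FreeGroup (Fin m)) (n + 1))))) ∧
    -- every other free presentation of `G` gives the same Baer invariant
    (∀ (Y : Type*) (π : FreeGroup Y →* FreeGroup (Fin m) ⧸ gamma (FreeGroup (Fin m)) (n + 1)),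
      Function.Surjective π →
        Nonempty (BaerInvariant {outerWord c₁ c₂} π.ker ≃*
          BaerInvariant {outerWord c₁ c₂} (gamma (FreeGroup (Fin m)) (n + 1)))) := by
  have hn' : 2 * n + c₁ < 2 * c₂ + 2 := by omega
  have hD : ∀ w ∈ setA ord n c₁ c₂ \ setC ord n c₁ c₂, commutatorValue w ∈
      gamma (FreeGroup (Fin m)) (n + 1) ⊓
        verbalSubgroup {outerWord c₁ c₂} (FreeGroup (Fin m)) := by
    intro w hw
    rw [gamma_inf_verbalSubgroup (by omega)]
    exact commutatorValue_mem_of_mem_setA hw.1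
  refine ⟨gamma_inf_verbalSubgroup (by omega), verbalCommutator_outerWord n c₁ c₂,
    fun w hw => isBasic_of_mem_setA hn' hw.1,
    ⟨hD, isFreeAbelianWithBasis_setA_diff_setC hc hn' hD⟩, fun Y π hπ => ?_⟩
  -- The Baer invariant is a type depending on the subgroup, so γ_{n+1} is generalized to K before
  -- being identified with the kernel of the quotient map.
  have key : ∀ (K : Subgroup (FreeGroup (Fin m))) [K.Normal],
      (QuotientGroup.mk' (gamma (FreeGroup (Fin m)) (n + 1))).ker = K →
        Nonempty (BaerInvariant {outerWord c₁ c₂} π.ker ≃*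
          BaerInvariant {outerWord c₁ c₂} K) := by
    rintro K _ rfl
    exact nonempty_baerInvariant_mulEquiv {outerWord c₁ c₂} π hπ _
      (QuotientGroup.mk'_surjective _)
  exact key _ (QuotientGroup.ker_mk' _)
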